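/- Let $k$ be a field of characteristic zero, let $n\ge 1$ and $\mathbf d=(d_1,\dots,d_n)$ with all $d_j\ge 1$, and let $A=k[x_1,\dots,x_n]/(x_1^{d_1},\dots,x_n^{d_n})$, $\ell=x_1+\cdots+x_n$ and $e=\sum_{j=1}^n(d_j-1)$ (the socle degree of $A$). Put $\mathbf d'=(d_1,\dots,d_{n-1})$ and, for every integer $j$, $h_j=\dim_k B_j$ where $B=k[x_1,\dots,x_{n-1}]/(x_1^{d_1},\dots,x_{n-1}^{d_{n-1}})$ (so $h_j=0$ for $j<0$; if $n=1$, then $B=k$). The determinant of the multiplication map $$\cdot\,\ell^{\,e-2i}:A_i\to A_{e-i}\qquad(0\le i\le e/2)$$ with respect to the bases of monomials $x^m$ with $m_j<d_j$ for all $j$ is an integer, well defined up to sign; let $a_{n,i,\mathbf d}$ denote its absolute value. For integers $t\ge 0$ and $1\le s<d$ let $C_{t,s,d}$ be the square matrix of size $d-s$ $$C_{t,s,d}=\begin{pmatrix}\binom{t}{d-1}&\binom{t}{d-2}&\cdots&\binom{t}{s}\\ \binom{t}{d-2}&\binom{t}{d-3}&\cdots&\binom{t}{s-1}\\ \vdots&\vdots&&\vdots\\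 \binom{t}{s}&\binom{t}{s-1}&\cdots&\binom{t}{2s-(d-1)}\end{pmatrix},$$ where $\binom{t}{m}=0$ for $m<0$ or $m>t$. Then for every integer $i$ with $0\le i\le e/2$, with $t=e-2i$, $$a_{n,i,\mathbf d}=\left(\prod_{j=\max\{0,d_n-t\}}^{\min\{i,d_n-1\}}a_{n-1,i-j,\mathbf d'}\right)\prod_{s=\max\{1,d_n-i-1\}}^{\min\{t-1,d_n-1\}}\left|\det C_{t,s,d_n}\right|^{\,h_{i+s-(d_n-1)}-h_{i+s-d_n}},$$ where empty products are $1$. In particular $a_{n,i,\mathbf d}\neq 0$ for all these $i$, and $A$ has the strong Lefschetz property: there is a linear form $\lambda\in A_1$ such that for all $i,t\ge 0$ the multiplication map $\cdot\,\lambda^t:A_i\to A_{i+t}$ is injective or surjective. -/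

import Mathlib

noncomputable section

namespace MonomialCI

open MvPolynomial

/-! ### Graded algebras and the strong Lefschetz property -/

/-- Multiplication by `ℓ ^ t`, as a linear map `A_i → A_{i+t}`, for `ℓ` of degree one. -/
def mulPow {k A : Type*} [Field k] [CommRing A] [Algebra k A] (𝒜 : ℕ → Submodule k A)
    [SetLike.GradedMonoid 𝒜] (ℓ : A) (hℓ : ℓ ∈ 𝒜 1) (i t : ℕ) : 𝒜 i →ₗ[k] 𝒜 (i + t) :=
  (LinearMap.mulLeft k (ℓ ^ t)).restrict (fun a ha => by
    have h1 : ℓ ^ t ∈ 𝒜 t := by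
      have := SetLike.pow_mem_graded t hℓ
      rwa [smul_eq_mul, mul_one] at this
    have h2 := SetLike.mul_mem_graded h1 ha
    rwa [add_comm] at h2)

/-- A linear map between finite dimensional spaces has full (that is, maximal) rank. -/
def FullRank {k V W : Type*} [Field k] [AddCommGroup V] [Module k V] [AddCommGroup W]
    [Module k W] (f : V →ₗ[k] W) : Prop :=
  Function.Injective f ∨ Function.Surjective f

/-- The strong Lefschetz property: some linear form `ℓ` has the property that every map
`ℓ ^ t : A_i → A_{i+t}` has full rank. -/
def HasSLP {k A : Type*} [Field k] [CommRing A] [Algebra k A] (𝒜 : ℕ → Submodule k A)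
    [SetLike.GradedMonoid 𝒜] : Prop :=
  ∃ (ℓ : A) (hℓ : ℓ ∈ 𝒜 1), ∀ i t : ℕ, FullRank (mulPow 𝒜 ℓ hℓ i t)

/-! ### Monomial complete intersections -/

/-- The ideal `(x_1^{d_1}, …, x_n^{d_n})`. -/
def powIdeal (k : Type*) [Field k] {n : ℕ} (d : Fin n → ℕ) : Ideal (MvPolynomial (Fin n) k) :=
  Ideal.span (Set.range fun j => X j ^ d j)

/-- The algebra `k[x_1, …, x_n] / (x_1^{d_1}, …, x_n^{d_n})`. -/
abbrev Alg (k : Type*) [Field k] {n : ℕ} (d : Fin n → ℕ) : Type _ :=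
  MvPolynomial (Fin n) k ⧸ powIdeal k d

/-- The degree `i` piece `A_i`: the classes of the homogeneous polynomials of degree `i`. -/
def piece (k : Type*) [Field k] {n : ℕ} (d : Fin n → ℕ) (i : ℕ) : Submodule k (Alg k d) :=
  (homogeneousSubmodule (Fin n) k i).map (Ideal.Quotient.mkₐ k (powIdeal k d)).toLinearMap

instance piece.gradedMonoid (k : Type*) [Field k] {n : ℕ} (d : Fin n → ℕ) :
    SetLike.GradedMonoid (piece k d) where
  one_mem := ⟨1, (mem_homogeneousSubmodule 0 1).2 (isHomogeneous_one _ _), by simp⟩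
  mul_mem := by
    rintro i j _ _ ⟨p, hp, rfl⟩ ⟨q, hq, rfl⟩
    exact ⟨p * q, (mem_homogeneousSubmodule _ _).2 (IsHomogeneous.mul
      ((mem_homogeneousSubmodule _ _).1 hp) ((mem_homogeneousSubmodule _ _).1 hq)), by simp⟩

/-- The linear form `ℓ = x_1 + ⋯ + x_n` in `A`. -/
def sumVars (k : Type*) [Field k] {n : ℕ} (d : Fin n → ℕ) : Alg k d :=
  Ideal.Quotient.mk (powIdeal k d) (∑ j, X j)

theorem sumVars_mem (k : Type*) [Field k] {n : ℕ} (d : Fin n → ℕ) :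
    sumVars k d ∈ piece k d 1 :=
  ⟨∑ j, X j, (mem_homogeneousSubmodule _ _).2
    (IsHomogeneous.sum _ _ _ fun j _ => isHomogeneous_X k j), rfl⟩

/-- `e = ∑ (d_j - 1)`. -/
def socleDegree {n : ℕ} (d : Fin n → ℕ) : ℕ := ∑ j, (d j - 1)

/-- The Hilbert function `h_j = dim A_j`, for every integer `j` (so `h_j = 0` for `j < 0`). -/
def hilb (k : Type*) [Field k] {n : ℕ} (d : Fin n → ℕ) (j : ℤ) : ℕ :=
  if 0 ≤ j then Module.finrank k (piece k d j.toNat) else 0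

/-! ### The monomial bases -/

/-- The exponents `m` of degree `i` with `m_j < d_j` for all `j`. -/
abbrev Expo {n : ℕ} (d : Fin n → ℕ) (i : ℕ) : Type :=
  {m : (j : Fin n) → Fin (d j) // ∑ j, (m j : ℕ) = i}

/-- The exponent as a finitely supported function. -/
def Expo.toFinsupp {n : ℕ} {d : Fin n → ℕ} {i : ℕ} (m : Expo d i) : Fin n →₀ ℕ :=
  Finsupp.equivFunOnFinite.symm fun j => (m.1 j : ℕ)

theorem Expo.toFinsupp_injective {n : ℕ} {d : Fin n → ℕ} {i : ℕ} :
    Function.Injective (Expo.toFinsupp (d := d) (i := i)) := by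
  intro m m' h
  apply Subtype.ext
  funext j
  exact Fin.ext (DFunLike.congr_fun h j)

theorem Expo.degree_toFinsupp {n : ℕ} {d : Fin n → ℕ} {i : ℕ} (m : Expo d i) :
    m.toFinsupp.degree = i := by
  rw [Finsupp.degree_eq_sum]
  exact m.2

/-- The class of the monomial `x^m` in `A_i`. -/
def mon (k : Type*) [Field k] {n : ℕ} (d : Fin n → ℕ) (i : ℕ) (m : Expo d i) : piece k d i :=
  ⟨Ideal.Quotient.mk (powIdeal k d) (monomial m.toFinsupp 1),
    ⟨monomial m.toFinsupp 1, (mem_homogeneousSubmodule _ _).2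
      (isHomogeneous_monomial 1 m.degree_toFinsupp), rfl⟩⟩

theorem mem_powIdeal (k : Type*) [Field k] {n : ℕ} (d : Fin n → ℕ)
    (p : MvPolynomial (Fin n) k) :
    p ∈ powIdeal k d ↔ ∀ m ∈ p.support, ∃ j, d j ≤ m j := by
  have h : powIdeal k d = Ideal.span
      ((fun s => monomial s (1 : k)) '' Set.range fun j => Finsupp.single j (d j)) := by
    unfold powIdeal
    congr 1
    ext q
    simp [X_pow_eq_monomial]
  rw [h, mem_ideal_span_monomial_image]
  simp

theorem linearIndependent_mon (k : Type*) [Field k] {n : ℕ} (d : Fin n → ℕ) (i : ℕ) :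
    LinearIndependent k (mon k d i) := by
  rw [Fintype.linearIndependent_iff]
  intro g hg m
  have h1 : (∑ m : Expo d i, monomial m.toFinsupp (g m)) ∈ powIdeal k d := by
    rw [← Ideal.Quotient.eq_zero_iff_mem, map_sum]
    have h2 := congrArg Subtype.val hg
    rw [AddSubmonoidClass.coe_finsetSum] at h2
    refine Eq.trans (Finset.sum_congr rfl fun m _ => ?_) h2
    have h3 : monomial m.toFinsupp (g m) = g m • monomial m.toFinsupp (1 : k) := by
      rw [smul_monomial, smul_eq_mul, mul_one]
    rw [h3]
    rfl
  rw [mem_powIdeal] at h1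
  by_contra hne
  have h4 : coeff m.toFinsupp (∑ m : Expo d i, monomial m.toFinsupp (g m)) = g m := by
    classical
    rw [coeff_sum, Finset.sum_eq_single m]
    · simp
    · intro b _ hb
      rw [coeff_monomial, if_neg fun h => hb (Expo.toFinsupp_injective h)]
    · simp
  obtain ⟨j, hj⟩ := h1 m.toFinsupp (by rw [mem_support_iff, h4]; exact hne)
  exact absurd (m.1 j).2 (not_lt.2 hj)

theorem span_mon (k : Type*) [Field k] {n : ℕ} (d : Fin n → ℕ) (i : ℕ) :
    ⊤ ≤ Submodule.span k (Set.range (mon k d i)) := by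
  rintro ⟨_, p, hp, rfl⟩ -
  have hp' := (mem_homogeneousSubmodule i p).1 hp
  suffices h : (Ideal.Quotient.mkₐ k (powIdeal k d)).toLinearMap p ∈
      (Submodule.span k (Set.range (mon k d i))).map (piece k d i).subtype by
    obtain ⟨y, hy, hy'⟩ := h
    have : y = ⟨_, p, hp, rfl⟩ := Subtype.ext hy'
    rwa [← this]
  rw [p.as_sum, map_sum]
  refine Submodule.sum_mem _ fun m hm => ?_
  have hdeg : m.degree = i := by
    rw [Finsupp.degree_eq_weight_one]
    exact hp' (mem_support_iff.1 hm)
  have hmon : monomial m (coeff m p) = coeff m p • monomial m (1 : k) := by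
    rw [smul_monomial, smul_eq_mul, mul_one]
  rw [hmon, map_smul]
  refine Submodule.smul_mem _ _ ?_
  by_cases hlt : ∀ j, m j < d j
  · let u : Expo d i := ⟨fun j => ⟨m j, hlt j⟩, by
      rw [Finsupp.degree_eq_sum] at hdeg; exact hdeg⟩
    have hu : u.toFinsupp = m := by ext j; rfl
    refine ⟨mon k d i u, Submodule.subset_span ⟨u, rfl⟩, ?_⟩
    rw [← hu]
    rfl
  · push Not at hlt
    have h0 : (Ideal.Quotient.mkₐ k (powIdeal k d)).toLinearMap (monomial m (1 : k)) = 0 := by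
      refine Ideal.Quotient.eq_zero_iff_mem.2 ((mem_powIdeal k d _).2 fun m' hm' => ?_)
      have := support_monomial_subset hm'
      rw [Finset.mem_singleton] at this
      rwa [this]
    rw [h0]
    exact Submodule.zero_mem _

/-- The basis of `A_i` that consists of the monomials `x^m` with `m_j < d_j` and `∑ m_j = i`. -/
def monBasis (k : Type*) [Field k] {n : ℕ} (d : Fin n → ℕ) (i : ℕ) :
    Module.Basis (Expo d i) k (piece k d i) :=
  Module.Basis.mk (linearIndependent_mon k d i) (span_mon k d i)

/-! ### The determinants -/

theorem sum_rev {n : ℕ} {d : Fin n → ℕ} (m : (j : Fin n) → Fin (d j)) :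
    ∑ j, ((m j).rev : ℕ) + ∑ j, (m j : ℕ) = socleDegree d := by
  rw [← Finset.sum_add_distrib]
  refine Finset.sum_congr rfl fun j _ => ?_
  have := (m j).2
  rw [Fin.val_rev]
  omega

/-- The bijection `m ↦ (d_j - 1 - m_j)_j` between the exponents of degrees `i` and `e - i`. -/
def complEquiv {n : ℕ} (d : Fin n → ℕ) (i t : ℕ) (h : 2 * i + t = socleDegree d) :
    Expo d (i + t) ≃ Expo d i where
  toFun m := ⟨fun j => (m.1 j).rev, by have := sum_rev m.1; have := m.2; dsimp only; omega⟩
  invFun m := ⟨fun j => (m.1 j).rev, by have := sum_rev m.1; have := m.2; dsimp only; omega⟩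
  left_inv m := by simp
  right_inv m := by simp

/-- The determinant of `ℓ ^ t : A_i → A_{i+t} = A_{e-i}`, `t = e - 2i`, with respect to the
monomial bases. Rows are matched with columns by `m ↦ (d_j - 1 - m_j)_j`; another ordering of the
two bases can only change the sign. -/
def lefschetzDet (k : Type*) [Field k] {n : ℕ} (d : Fin n → ℕ) (i t : ℕ)
    (h : 2 * i + t = socleDegree d) : k :=
  (LinearMap.toMatrix (monBasis k d i)
    ((monBasis k d (i + t)).reindex (complEquiv d i t h))
    (mulPow (piece k d) (sumVars k d) (sumVars_mem k d) i t)).det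

/-- The absolute value `m` of an element `± m` (`m` a natural number) of a field of
characteristic zero; the value is meaningless for other elements. -/
def absVal {k : Type*} [Field k] (x : k) : ℕ :=
  sInf {m : ℕ | x = (m : k) ∨ x = -(m : k)}

/-- `a_{n,i,d}`: the absolute value of the determinant of `ℓ ^ (e - 2i) : A_i → A_{e-i}`, for
`i ≤ e / 2` (and `0` for other `i`). -/
def absDet (k : Type*) [Field k] {n : ℕ} (d : Fin n → ℕ) (i : ℕ) : ℕ :=
  if h : 2 * i ≤ socleDegree d then
    absVal (lefschetzDet k d i (socleDegree d - 2 * i) (by omega))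
  else 0

/-- The matrix `C_{t,s,d}` of size `d - s` whose entry in row `r` and column `c`, counted from
zero, is `binom(t, d - 1 - r - c)`, where `binom(t, m) = 0` for `m < 0`. -/
def matC (t s d : ℕ) : Matrix (Fin (d - s)) (Fin (d - s)) ℤ :=
  Matrix.of fun r c =>
    if (r : ℕ) + (c : ℕ) ≤ d - 1 then (t.choose (d - 1 - (r + c)) : ℤ) else 0

end MonomialCI

end

/-! Write A = B ⊗ k[x]/(x^d), where d = d_n, and let e' be the socle degree of B. By induction the
sum of the first n - 1 variables is a Lefschetz element on B, so B has a graded basis of strings u,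
Tu, …, T^(e'-2p)u with u primitive of degree p, and h_p - h_(p-1) strings start in degree p. Each
string tensored with k[x]/(x^d) is a shifted copy of the two-variable algebra k[y,x]/(y^(e'-2p+1),
x^d) with ℓ acting as y + x. There ℓ^t is a Toeplitz matrix of binomials. It is unitriangular,
empty, or, up to the order of its rows, C_{t,s,d} with s = p + d - 1 - i (`gram_string`). This gives
the second product.

The first product comes from the change of basis. If g(z) measures the base change of B in degree z,
then a(z) g(z) = g(e' - z), because ℓ^(e'-2z) becomes a permutation of string vectors. In A the base
change contributes the quotient of ∏ g(i + t - j) by ∏ g(i - j), which collapses to the a_{n-1,i-j}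
(`prod_reflect_eq`). These facts are assembled in `gram_adjoinMul_pow`.

The induction continues because det C_{t,s,d} ≠ 0: a kernel vector would give a nonzero multiple of
(X + 1)^t with at most t terms, against Hajós's bound (`det_matC_ne_zero`). Signs and orderings of
bases are avoided by computing with squares of determinants, in the form det(M Mᵀ), over ℚ; the
determinants are images of integers, so this suffices for every k of characteristic zero. -/

noncomputable section

namespace MonomialCI

open Matrix
open scoped Kronecker

/-! ### Gram determinants -/

section Gram

variable {R : Type*} [CommRing R] {m n l : Type*}

/-- The Gram determinant of the rows of a matrix. For a matrix which is square up to a bijection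
between the two index sets, it is the square of the determinant. -/
def gram [Fintype m] [DecidableEq m] [Fintype n] (M : Matrix m n R) : R := (M * Mᵀ).det

/-- Rows and columns may be reindexed independently, by index types with no canonical bijection
between them. This is the advantage of Gram determinants over determinants here. -/
theorem gram_submatrix {m' n' : Type*} [Fintype m] [DecidableEq m] [Fintype n] [Fintype m']
    [DecidableEq m'] [Fintype n'] (e : m' ≃ m) (f : n' ≃ n) (M : Matrix m n R) :
    gram (M.submatrix e f) = gram M := by
  rw [gram, transpose_submatrix, submatrix_mul_equiv, det_submatrix_equiv_self, gram]

theorem gram_eq_sq [Fintype n] [DecidableEq n] (M : Matrix n n R) : gram M = M.det ^ 2 := by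
  rw [gram, det_mul, det_transpose, sq]

theorem gram_of_isEmpty [Fintype m] [DecidableEq m] [Fintype n] [IsEmpty m] (M : Matrix m n R) :
    gram M = 1 := det_isEmpty

theorem gram_one [Fintype n] [DecidableEq n] : gram (1 : Matrix n n R) = 1 := by
  simp [gram]

/-- Only the first factor has to be square up to a bijection: the square matrix it becomes can be
pulled out of det(M N Nᵀ Mᵀ). -/
theorem gram_mul [Fintype m] [DecidableEq m] [Fintype n] [DecidableEq n] [Fintype l]
    (M : Matrix m n R) (N : Matrix n l R) (h : Fintype.card m = Fintype.card n) :
    gram (M * N) = gram M * gram N := by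
  let e := Fintype.equivOfCardEq h
  have h1 : M * N = M.submatrix id e * N.submatrix e id := by
    rw [submatrix_mul_equiv, submatrix_id_id]
  have h2 : gram M = (M.submatrix id e).det ^ 2 := by
    rw [← gram_eq_sq]
    exact (gram_submatrix (Equiv.refl m) e M).symm
  have h3 : gram N = gram (N.submatrix e id) := (gram_submatrix e (Equiv.refl l) N).symm
  rw [h1, h2, h3, gram, gram, transpose_mul, ← Matrix.mul_assoc, Matrix.mul_assoc (M.submatrix id e),
    det_mul, det_mul, det_transpose]
  ring

theorem det_blockDiagonal' {o : Type*} [Fintype o] [DecidableEq o] {m : o → Type*}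
    [∀ i, Fintype (m i)] [∀ i, DecidableEq (m i)] (M : ∀ i, Matrix (m i) (m i) R) :
    (blockDiagonal' M).det = ∏ i, (M i).det := by
  let e := Fintype.equivFin o
  let : LinearOrder o := LinearOrder.lift' e e.injective
  have h := (blockTriangular_blockDiagonal' M).det_fintype
  rw [h]
  refine Finset.prod_congr rfl fun i _ => ?_
  let f : m i ≃ {a : Σ i, m i // Sigma.fst a = i} :=
    { toFun := fun a => ⟨⟨i, a⟩, rfl⟩
      invFun := fun a => a.2 ▸ a.1.2
      left_inv := fun a => rfl
      right_inv := by rintro ⟨⟨j, a⟩, rfl⟩; rfl }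
  rw [← det_submatrix_equiv_self f]
  congr 1
  ext a b
  simp [f, toSquareBlock_def]

theorem gram_blockDiagonal' {o : Type*} [Fintype o] [DecidableEq o] {m n : o → Type*}
    [∀ i, Fintype (m i)] [∀ i, DecidableEq (m i)] [∀ i, Fintype (n i)]
    (M : ∀ i, Matrix (m i) (n i) R) : gram (blockDiagonal' M) = ∏ i, gram (M i) := by
  rw [gram, blockDiagonal'_transpose, ← blockDiagonal'_mul, det_blockDiagonal']
  rfl

end Gram

/-! ### Graded blocks -/

section Block

variable {R : Type*} [CommRing R] {ι κ μ : Type*}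

/-- The block of a matrix in which the rows have degree `p` and the columns have degree `q`. -/
def block (f : ι → ℤ) (g : κ → ℤ) (X : Matrix ι κ R) (p q : ℤ) :
    Matrix {a // f a = p} {b // g b = q} R := X.submatrix Subtype.val Subtype.val

/-- The columns of `Y` of degree `q` are supported in the single degree `r`, so only that degree
survives in the sum over the middle index. -/
theorem block_mul [Fintype κ] {f : ι → ℤ} {g : κ → ℤ} {h : μ → ℤ} {X : Matrix ι κ R}
    {Y : Matrix κ μ R} {p q r : ℤ} (hY : ∀ b c, h c = q → g b ≠ r → Y b c = 0) :
    block f h (X * Y) p q = block f g X p r * block g h Y r q := by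
  ext a c
  simp only [block, submatrix_apply, mul_apply]
  rw [← Finset.sum_subtype (Finset.univ.filter fun b => g b = r) (by simp)
    (fun b => X a b * Y b c), Finset.sum_filter_of_ne]
  intro b _ hb
  by_contra hne
  exact hb (by rw [hY b c c.2 hne, mul_zero])

theorem block_one [DecidableEq ι] (f : ι → ℤ) (p : ℤ) :
    block f f (1 : Matrix ι ι R) p p = 1 := submatrix_one _ Subtype.val_injective

variable [Fintype ι] [Fintype κ] [DecidableEq ι]

theorem gram_block_submatrix {ι' κ' : Type*} [Fintype ι'] [Fintype κ'] [DecidableEq ι']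
    (e : ι' ≃ ι) (e' : κ' ≃ κ) (f : ι → ℤ) (g : κ → ℤ) (X : Matrix ι κ R) (p q : ℤ) :
    gram (block (f ∘ e) (g ∘ e') (X.submatrix e e') p q) = gram (block f g X p q) :=
  gram_submatrix (e.subtypeEquiv (fun _ => Iff.rfl) : {a // (f ∘ e) a = p} ≃ {a // f a = p})
    (e'.subtypeEquiv (fun _ => Iff.rfl) : {a // (g ∘ e') a = q} ≃ {a // g a = q})
    (block f g X p q)

/-- A subtype of a sigma type is a sigma type of subtypes. -/
def subtypeSigma {o : Type*} {m : o → Type*} (P : (Σ i, m i) → Prop) :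
    {x // P x} ≃ Σ i, {a : m i // P ⟨i, a⟩} where
  toFun x := ⟨x.1.1, x.1.2, x.2⟩
  invFun x := ⟨⟨x.1, x.2.1⟩, x.2.2⟩
  left_inv _ := rfl
  right_inv _ := rfl

theorem gram_block_blockDiagonal' {o : Type*} [Fintype o] [DecidableEq o] {m n : o → Type*}
    [∀ i, Fintype (m i)] [∀ i, DecidableEq (m i)] [∀ i, Fintype (n i)] (f : (Σ i, m i) → ℤ)
    (g : (Σ i, n i) → ℤ) (X : ∀ i, Matrix (m i) (n i) R) (p q : ℤ) :
    gram (block f g (blockDiagonal' X) p q) =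
      ∏ i, gram (block (fun a => f ⟨i, a⟩) (fun b => g ⟨i, b⟩) (X i) p q) := by
  rw [← gram_blockDiagonal', ← gram_submatrix (subtypeSigma fun x => f x = p)
    (subtypeSigma fun x => g x = q)]
  congr 1
  ext ⟨⟨i, a⟩, ha⟩ ⟨⟨j, b⟩, hb⟩
  by_cases hij : i = j
  · subst hij
    simp [subtypeSigma, block]
  · simp [subtypeSigma, block, blockDiagonal'_apply_ne, hij]

/-- `X ⊗ₖ 1` preserves the exponent j of the new variable, so its part of degree `p` splits into the
parts of `X` of degree `p - j`. -/
theorem gram_block_kronecker_one {d : ℕ} (f : ι → ℤ) (g : κ → ℤ) (X : Matrix ι κ R) (p : ℤ) :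
    gram (block (fun x : ι × Fin d => f x.1 + x.2) (fun x : κ × Fin d => g x.1 + x.2)
      (X ⊗ₖ (1 : Matrix (Fin d) (Fin d) R)) p p) =
      ∏ j ∈ Finset.range d, gram (block f g X (p - j) (p - j)) := by
  let e := (Equiv.prodComm ι (Fin d)).trans (Equiv.sigmaEquivProd (Fin d) ι).symm
  let e' := (Equiv.prodComm κ (Fin d)).trans (Equiv.sigmaEquivProd (Fin d) κ).symm
  have h1 : X ⊗ₖ (1 : Matrix (Fin d) (Fin d) R) =
      (blockDiagonal' fun _ : Fin d => X).submatrix e e' := by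
    rw [kronecker_one]
    rfl
  rw [h1]
  have h2 := gram_block_submatrix e e' (fun x => f x.2 + x.1) (fun x => g x.2 + x.1)
    (blockDiagonal' fun _ : Fin d => X) p p
  refine h2.trans ?_
  rw [gram_block_blockDiagonal', Finset.prod_range]
  refine Finset.prod_congr rfl fun j _ => ?_
  exact gram_submatrix (Equiv.subtypeEquivRight fun a => by dsimp only; omega)
    (Equiv.subtypeEquivRight fun a => by dsimp only; omega) (block f g X (p - j) (p - j))

theorem gram_block_eq_one_of_isEmpty (f : ι → ℤ) (g : κ → ℤ) (X : Matrix ι κ R) {p : ℤ} (q : ℤ)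
    (h : ∀ a, f a ≠ p) : gram (block f g X p q) = 1 := by
  have : IsEmpty {a // f a = p} := ⟨fun a => h a.1 a.2⟩
  exact gram_of_isEmpty _

end Block

/-! ### Polynomials divisible by a power of `X + 1` -/

section Hajos

open Polynomial

/-- A nonzero polynomial in characteristic zero which is divisible by `(X + 1) ^ t` has more than
`t` terms (Hajós). -/
theorem lt_card_support_of_dvd {F : Type*} [Field F] [CharZero F] (t : ℕ) :
    ∀ f : F[X], f ≠ 0 → (X + 1) ^ t ∣ f → t < f.support.card := by
  induction t with
  | zero =>
    intro f hf _
    exact Finset.card_pos.2 (nonempty_support_iff.2 hf)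
  | succ t ih =>
    intro f hf hdvd
    let r := f.natTrailingDegree
    -- This operator multiplies the coefficient of X^j by j - r: it removes exactly the lowest term
    -- and costs only one factor X + 1.
    let g : F[X] := X * derivative f - C (r : F) * f
    have hc : ∀ j, g.coeff j = ((j : F) - r) * f.coeff j := by
      intro j
      rcases j with _ | j
      · simp [g]
      · simp [g, coeff_X_mul, coeff_derivative]
        ring
    have hr : r ∈ f.support := natTrailingDegree_mem_support_of_nonzero hf
    have hsupp : g.support = f.support.erase r := by
      ext j
      simp [hc, sub_eq_zero]
    -- Otherwise `f` is a single term, which does not vanish at -1.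
    have hg : g ≠ 0 := by
      intro h0
      have h1 : f.support = {r} := by
        rw [h0, support_zero] at hsupp
        rw [← Finset.insert_erase hr, ← hsupp]
        rfl
      have h2 : f = C (f.coeff r) * X ^ r := by
        conv_lhs => rw [f.as_sum_support, h1, Finset.sum_singleton]
        rw [C_mul_X_pow_eq_monomial]
      have h3 : f.eval (-1) = 0 := by
        obtain ⟨q, hq⟩ := hdvd
        rw [hq]
        simp
      rw [h2] at h3
      simp at h3
      exact (mem_support_iff.1 hr) h3
    have hdvd' : (X + 1) ^ t ∣ g := by
      refine dvd_sub (Dvd.dvd.mul_left ?_ _) (Dvd.dvd.mul_left ((pow_dvd_pow _ t.le_succ).trans hdvd) _)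
      obtain ⟨q, hq⟩ := hdvd
      rw [hq, derivative_mul, derivative_pow]
      simp only [Nat.add_sub_cancel]
      refine dvd_add ?_ ?_
      · exact Dvd.dvd.mul_right (Dvd.dvd.mul_right (Dvd.intro_left _ rfl) _) _
      · exact Dvd.dvd.mul_right (pow_dvd_pow _ t.le_succ) _
    have := ih g hg hdvd'
    rw [hsupp, Finset.card_erase_of_mem hr] at this
    omega

/-- A kernel vector is the coefficient vector of a polynomial f of degree less than d - s such that
(X + 1)^t f has no terms in degrees s, …, d - 1. What remains are s degrees below and at most t - s
above, so at most t terms, contradicting `lt_card_support_of_dvd`. -/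
theorem det_matC_ne_zero {t s d : ℕ} (hst : s ≤ t) (hsd : s < d) : (matC t s d).det ≠ 0 := by
  intro h0
  have h1 : ((matC t s d).map (Int.castRingHom ℚ)).det = 0 := by
    rw [← RingHom.mapMatrix_apply, ← RingHom.map_det, h0, map_zero]
  obtain ⟨v, hv, hmul⟩ := exists_mulVec_eq_zero_iff.2 h1
  let f : ℚ[X] := ∑ c : Fin (d - s), monomial (c : ℕ) (v c)
  have hcoeff : ∀ c : Fin (d - s), f.coeff c = v c := by
    intro c
    simp only [f, finsetSum_coeff, coeff_monomial]
    rw [Finset.sum_eq_single c]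
    · simp
    · intro b _ hb
      rw [if_neg fun h => hb (Fin.ext h)]
    · simp
  have hf : f ≠ 0 := by
    intro hf0
    refine hv (funext fun c => ?_)
    rw [← hcoeff, hf0]
    rfl
  have hgc : ∀ j, ((X + 1) ^ t * f).coeff j =
      ∑ c : Fin (d - s), if (c : ℕ) ≤ j then (t.choose (j - c) : ℚ) * v c else 0 := by
    intro j
    simp only [f, Finset.mul_sum, finsetSum_coeff]
    refine Finset.sum_congr rfl fun c _ => ?_
    rw [← C_mul_X_pow_eq_monomial, ← mul_assoc, coeff_mul_X_pow', mul_comm, coeff_C_mul,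
      coeff_X_add_one_pow, mul_comm]
  have hsub : ((X + 1) ^ t * f).support ⊆ Finset.range s ∪ Finset.Ico d (d + (t - s)) := by
    intro j hj
    rw [mem_support_iff] at hj
    rw [Finset.mem_union, Finset.mem_range, Finset.mem_Ico]
    by_contra hcon
    push Not at hcon
    refine hj ?_
    rw [hgc]
    by_cases hjd : j < d
    -- Row d - 1 - j of the matrix computes the coefficient of X^j.
    · have h2 := congrFun hmul ⟨d - 1 - j, by omega⟩
      simp only [mulVec, dotProduct, Pi.zero_apply, map_apply] at h2
      refine Eq.trans (Finset.sum_congr rfl fun c _ => ?_) h2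
      simp only [matC, of_apply]
      have h3 : d - 1 - (d - 1 - j + (c : ℕ)) = j - c := by omega
      rw [h3]
      by_cases hc : (c : ℕ) ≤ j
      · rw [if_pos hc, if_pos (by omega)]
        simp
      · rw [if_neg hc, if_neg (by omega)]
        simp
    · refine Finset.sum_eq_zero fun c _ => ?_
      rw [Nat.choose_eq_zero_of_lt (by omega)]
      simp
  have h4 := lt_card_support_of_dvd t _ (mul_ne_zero (pow_ne_zero _ (X_add_C_ne_zero (1 : ℚ))) hf)
    (Dvd.intro _ rfl)
  have h5 := (Finset.card_le_card hsub).trans (Finset.card_union_le _ _)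
  rw [Finset.card_range, Nat.card_Ico] at h5
  rw [C_1] at h4
  omega

end Hajos

/-! ### The case of two variables -/

section TwoVariables

variable (R : Type*) [CommRing R]

/-- The nilpotent shift `e_b ↦ e_{b+1}` on a space of dimension `q`. -/
def shift (q : ℕ) : Matrix (Fin q) (Fin q) R :=
  of fun a b => if (a : ℕ) = b + 1 then 1 else 0

/-- The matrix of multiplication by `y + x` on `k[y, x] / (y ^ q, x ^ d)`. -/
def twoShift (q d : ℕ) : Matrix (Fin q × Fin d) (Fin q × Fin d) R :=
  shift R q ⊗ₖ 1 + 1 ⊗ₖ shift R d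

variable {R}

theorem sum_mul_shift {q : ℕ} (x : Fin q → R) (y : R) (b : Fin q) :
    ∑ a, x a * (shift R q a b * y) = if h : (b : ℕ) + 1 < q then x ⟨b + 1, h⟩ * y else 0 := by
  split_ifs with h
  · rw [Finset.sum_eq_single ⟨b + 1, h⟩]
    · simp [shift]
    · intro a _ ha
      have : (a : ℕ) ≠ b + 1 := fun h' => ha (Fin.ext h')
      simp [shift, this]
    · simp
  · refine Finset.sum_eq_zero fun a _ => ?_
    have : (a : ℕ) ≠ b + 1 := by omega
    simp [shift, this]

/-- This is the binomial expansion of (y + x)^t. No condition on the y-exponents is needed: if they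
decrease, the degree condition forces the x-exponent to grow by more than `t`, and the binomial is
zero. -/
theorem twoShift_pow_apply (q d t : ℕ) (x y : Fin q × Fin d) :
    (twoShift R q d ^ t) x y =
      if (x.1 : ℕ) + x.2 = y.1 + y.2 + t ∧ (y.2 : ℕ) ≤ x.2 then
        (t.choose (x.2 - y.2) : R) else 0 := by
  induction t generalizing y with
  | zero =>
    obtain ⟨a', j'⟩ := x
    obtain ⟨a, j⟩ := y
    rw [pow_zero, one_apply]
    dsimp only
    by_cases h : a' = a ∧ j' = j
    · obtain ⟨rfl, rfl⟩ := h
      simp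
    · rw [if_neg (by simpa using h)]
      split_ifs with h2
      · rw [Nat.choose_eq_zero_of_lt, Nat.cast_zero]
        by_contra h3
        exact h ⟨Fin.ext (by omega), Fin.ext (by omega)⟩
      · rfl
  | succ t ih =>
    obtain ⟨a', j'⟩ := x
    obtain ⟨a, j⟩ := y
    have h1 : ∑ b : Fin q, ∑ l : Fin d, (twoShift R q d ^ t) (a', j') (b, l) *
        (shift R q ⊗ₖ (1 : Matrix (Fin d) (Fin d) R)) (b, l) (a, j) =
        if h : (a : ℕ) + 1 < q then
          (twoShift R q d ^ t) (a', j') (⟨a + 1, h⟩, j) * 1 else 0 := by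
      refine Eq.trans (Finset.sum_congr rfl fun b _ => ?_)
        (sum_mul_shift (fun b => (twoShift R q d ^ t) (a', j') (b, j)) 1 a)
      rw [Finset.sum_eq_single j]
      · simp [kroneckerMap_apply]
      · intro l _ hl
        simp [kroneckerMap_apply, hl]
      · simp
    have h2 : ∑ b : Fin q, ∑ l : Fin d, (twoShift R q d ^ t) (a', j') (b, l) *
        ((1 : Matrix (Fin q) (Fin q) R) ⊗ₖ shift R d) (b, l) (a, j) =
        if h : (j : ℕ) + 1 < d then
          (twoShift R q d ^ t) (a', j') (a, ⟨j + 1, h⟩) * 1 else 0 := by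
      refine Eq.trans ?_ (sum_mul_shift (fun l => (twoShift R q d ^ t) (a', j') (a, l)) 1 j)
      rw [Finset.sum_eq_single a]
      · simp [kroneckerMap_apply]
      · intro b _ hb
        simp [kroneckerMap_apply, hb]
      · simp
    rw [pow_succ, mul_apply, Fintype.sum_prod_type]
    conv_lhs =>
      enter [2, b, 2, l]
      rw [show twoShift R q d (b, l) (a, j) =
        (shift R q ⊗ₖ (1 : Matrix (Fin d) (Fin d) R)) (b, l) (a, j) +
        ((1 : Matrix (Fin q) (Fin q) R) ⊗ₖ shift R d) (b, l) (a, j) from rfl, mul_add]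
    simp only [Finset.sum_add_distrib]
    rw [h1, h2]
    simp only [ih, mul_one]
    have ha' := a'.2
    have hj' := j'.2
    by_cases hdeg : (a' : ℕ) + j' = a + j + (t + 1)
    · have e1 : (if h : (a : ℕ) + 1 < q then
          if (a' : ℕ) + j' = a + 1 + j + t ∧ (j : ℕ) ≤ j' then
            ((t.choose (j' - j) : ℕ) : R) else 0 else 0) =
          if (j : ℕ) ≤ j' then ((t.choose (j' - j) : ℕ) : R) else 0 := by
        by_cases h : (a : ℕ) + 1 < q
        · rw [dif_pos h]
          refine if_congr ?_ rfl rfl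
          omega
        · rw [dif_neg h, Nat.choose_eq_zero_of_lt (by omega)]
          simp
      have e2 : (if h : (j : ℕ) + 1 < d then
          if (a' : ℕ) + j' = a + (j + 1) + t ∧ (j : ℕ) + 1 ≤ j' then
            ((t.choose (j' - (j + 1)) : ℕ) : R) else 0 else 0) =
          if (j : ℕ) + 1 ≤ j' then ((t.choose (j' - (j + 1)) : ℕ) : R) else 0 := by
        by_cases h : (j : ℕ) + 1 < d
        · rw [dif_pos h]
          refine if_congr ?_ rfl rfl
          omega
        · rw [dif_neg h, if_neg (by omega)]
      rw [e1, e2]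
      rcases lt_trichotomy (j : ℕ) j' with h | h | h
      · rw [if_pos h.le, if_pos (Nat.succ_le_of_lt h), if_pos ⟨hdeg, h.le⟩]
        obtain ⟨u, hu⟩ := Nat.exists_eq_add_of_lt h
        have h3 : (j' : ℕ) - j = u + 1 := by omega
        have h4 : (j' : ℕ) - (j + 1) = u := by omega
        rw [h3, h4, Nat.choose_succ_succ]
        push_cast
        ring
      · rw [if_pos h.le, if_neg (by omega), if_pos ⟨hdeg, h.le⟩, h]
        simp
      · rw [if_neg (by omega), if_neg (by omega), if_neg (by omega), add_zero]
    · have e1 : ¬ (a' : ℕ) + j' = a + 1 + j + t := by omega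
      have e2 : ¬ (a' : ℕ) + j' = a + (j + 1) + t := by omega
      simp [e1, e2, hdeg]

/-- A Toeplitz matrix of binomial coefficients. -/
def toeplitz (t lo lo' N : ℕ) : Matrix (Fin N) (Fin N) R :=
  of fun r c => if lo + (c : ℕ) ≤ lo' + r then (t.choose (lo' + r - (lo + c)) : R) else 0

/-- An antidiagonal of a rectangle is an interval. -/
def antidiagEquiv (q d N lo : ℕ) (p z : ℤ)
    (h : ∀ j : ℕ, (lo ≤ j ∧ j < lo + N) ↔ (j < d ∧ p ≤ z - j ∧ z - j < p + q)) :
    Fin N ≃ {x : Fin q × Fin d // p + (x.1 : ℤ) + (x.2 : ℤ) = z} where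
  toFun c := ⟨(⟨(z - p - (lo + c : ℕ)).toNat, by have := (h (lo + c)).1 (by omega); omega⟩,
    ⟨lo + c, ((h (lo + c)).1 (by omega)).1⟩), by
      have := (h (lo + c)).1 (by omega)
      dsimp only
      omega⟩
  invFun x := ⟨(x.1.2 : ℕ) - lo, by
    have := (h x.1.2).2 ⟨x.1.2.2, by have := x.2; omega, by have := x.2; have := x.1.1.2; omega⟩
    omega⟩
  left_inv c := by simp
  right_inv x := by
    have h1 := (h x.1.2).2
      ⟨x.1.2.2, by have := x.2; omega, by have := x.2; have := x.1.1.2; omega⟩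
    have h2 := x.2
    apply Subtype.ext
    apply Prod.ext
    · apply Fin.ext
      dsimp only
      omega
    · apply Fin.ext
      dsimp only
      omega

/-- The hypotheses `h` and `h'` say that the x-exponents occurring in degrees `i` and `i + t` form
intervals of the same length `N`, starting at `lo` and `lo'`. Indexing by these exponents gives a
Toeplitz matrix. -/
theorem gram_twoShift (q d t N lo lo' : ℕ) (p i : ℤ)
    (h : ∀ j : ℕ, (lo ≤ j ∧ j < lo + N) ↔ (j < d ∧ p ≤ i - j ∧ i - j < p + q))
    (h' : ∀ j : ℕ, (lo' ≤ j ∧ j < lo' + N) ↔ (j < d ∧ p ≤ i + t - j ∧ i + t - j < p + q)) :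
    gram (block (fun x : Fin q × Fin d => p + (x.1 : ℤ) + (x.2 : ℤ))
      (fun x : Fin q × Fin d => p + (x.1 : ℤ) + (x.2 : ℤ)) (twoShift R q d ^ t) (i + t) i) =
      (toeplitz t lo lo' N : Matrix _ _ R).det ^ 2 := by
  rw [← gram_eq_sq, ← gram_submatrix (antidiagEquiv q d N lo' p (i + t) h')
    (antidiagEquiv q d N lo p i h)]
  congr 1
  ext r c
  simp only [submatrix_apply, block, twoShift_pow_apply, toeplitz, of_apply]
  have h1 := (antidiagEquiv q d N lo' p (i + t) h' r).2
  have h2 := (antidiagEquiv q d N lo p i h c).2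
  have h3 : ((antidiagEquiv q d N lo' p (i + t) h' r).1.2 : ℕ) = lo' + r := rfl
  have h4 : ((antidiagEquiv q d N lo p i h c).1.2 : ℕ) = lo + c := rfl
  rw [h3, h4]
  refine if_congr ?_ rfl rfl
  omega

theorem det_toeplitz_of_le (t N lo : ℕ) : (toeplitz t lo lo N : Matrix _ _ R).det = 1 := by
  rw [det_of_isLowerTriangular]
  · simp [toeplitz]
  · intro r c hrc
    have : (r : ℕ) < c := hrc
    simp only [toeplitz, of_apply]
    rw [if_neg (by omega)]

theorem det_toeplitz_add (t N lo : ℕ) : (toeplitz t lo (lo + t) N : Matrix _ _ R).det = 1 := by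
  rw [det_of_isUpperTriangular]
  · refine Finset.prod_eq_one fun r _ => ?_
    simp only [toeplitz, of_apply]
    rw [if_pos (by omega), show lo + t + (r : ℕ) - (lo + r) = t by omega]
    simp
  · intro r c hrc
    have : (c : ℕ) < r := hrc
    simp only [toeplitz, of_apply]
    rw [if_pos (by omega), Nat.choose_eq_zero_of_lt (by omega), Nat.cast_zero]

/-- Reversing the rows turns the Toeplitz matrix into the Hankel matrix C; the sign of this
permutation disappears in the square. -/
theorem det_toeplitz_sq (t s d : ℕ) :
    (toeplitz t 0 s (d - s) : Matrix _ _ ℚ).det ^ 2 = ((matC t s d).det : ℚ) ^ 2 := by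
  have h : (((matC t s d).det : ℤ) : ℚ) = ((matC t s d).map (Int.castRingHom ℚ)).det := by
    rw [← RingHom.mapMatrix_apply, ← RingHom.map_det]
    rfl
  rw [h, ← gram_eq_sq, ← gram_eq_sq, ← gram_submatrix Fin.revPerm (Equiv.refl _)]
  congr 1
  ext r c
  have hr := r.2
  simp only [submatrix_apply, toeplitz, matC, of_apply, map_apply, Fin.revPerm_apply, Fin.val_rev,
    Equiv.refl_apply]
  rw [show s + (d - s - ((r : ℕ) + 1)) - (0 + c) = d - 1 - (r + c) by omega]
  by_cases h : (r : ℕ) + c ≤ d - 1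
  · rw [if_pos h, if_pos (by omega)]
    simp
  · rw [if_neg h, if_neg (by omega)]
    simp

/-- The contribution of one string to the square of the Lefschetz determinant. -/
theorem gram_string (e' i t d p : ℕ) (hd : 1 ≤ d) (he : 2 * i + t = e' + (d - 1))
    (hp : 2 * p ≤ e') :
    gram (block (fun x : Fin (e' - 2 * p + 1) × Fin d => (p : ℤ) + (x.1 : ℤ) + (x.2 : ℤ))
      (fun x : Fin (e' - 2 * p + 1) × Fin d => (p : ℤ) + (x.1 : ℤ) + (x.2 : ℤ))
      (twoShift ℚ (e' - 2 * p + 1) d ^ t) ((i : ℤ) + t) i) =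
      if p + (d - 1) - i ∈ Finset.Icc (max 1 (d - i - 1)) (min (t - 1) (d - 1)) then
        ((matC t (p + (d - 1) - i) d).det : ℚ) ^ 2 else 1 := by
  split_ifs with h
  · rw [Finset.mem_Icc] at h
    -- With s = p + d - 1 - i, the x-exponents run over 0, …, d - 1 - s in degree i and over s, …, d
    -- - 1 in degree i + t.
    rw [gram_twoShift _ _ _ (d - (p + (d - 1) - i)) 0 (p + (d - 1) - i), det_toeplitz_sq]
    · omega
    · omega
  · rw [Finset.mem_Icc] at h
    by_cases hpi : i < p
    · refine gram_block_eq_one_of_isEmpty _ _ _ _ ?_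
      rintro ⟨a, b⟩
      dsimp only
      omega
    -- Here all d powers of x occur in both degrees, and the matrix is triangular with binom(t, 0)
    -- on the diagonal.
    by_cases hs : p + (d - 1) ≤ i
    · rw [gram_twoShift _ _ _ d 0 0, det_toeplitz_of_le, one_pow]
      · omega
      · omega
    -- The remaining case is s ≥ t. All powers of y occur in both degrees, the x-exponents are
    -- shifted by t, and the diagonal entries are binom(t, t).
    · have h1 : p + (d - 1) - i = p + (d - 1) - i - t + t := by omega
      rw [gram_twoShift _ _ _ (d + t - 2 * (p + (d - 1) - i)) (p + (d - 1) - i - t)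
        (p + (d - 1) - i - t + t), det_toeplitz_add, one_pow]
      · omega
      · omega

end TwoVariables

/-! ### Decomposition into strings -/

section Strings

variable {F V : Type*} [Field F] [AddCommGroup V] [Module F V]

/-- `T` raises degrees by one, and its powers are bijections between opposite degrees. -/
structure IsLefschetz (W : ℤ → Submodule F V) (T : Module.End F V) (e : ℕ) : Prop where
  map : ∀ z, ∀ x ∈ W z, T x ∈ W (z + 1)
  inj : ∀ p : ℕ, 2 * p ≤ e → ∀ x ∈ W p, (T ^ (e - 2 * p)) x = 0 → x = 0
  surj : ∀ p : ℕ, 2 * p ≤ e → ∀ y ∈ W (e - p), ∃ x ∈ W p, (T ^ (e - 2 * p)) x = y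
  neg : ∀ z, z < 0 → W z = ⊥
  lt : ∀ z, (e : ℤ) < z → W z = ⊥

/-- The primitive elements of degree `p`. -/
def primitive (W : ℤ → Submodule F V) (T : Module.End F V) (e p : ℕ) : Submodule F V :=
  W p ⊓ LinearMap.ker (T ^ (e - 2 * p + 1))

variable {W : ℤ → Submodule F V} {T : Module.End F V} {e : ℕ}

namespace IsLefschetz

theorem pow_mem (h : IsLefschetz W T e) (a : ℕ) {z : ℤ} {x : V} (hx : x ∈ W z) :
    (T ^ a) x ∈ W (z + a) := by
  induction a with
  | zero => simpa using hx
  | succ a ih =>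
    rw [pow_succ', Module.End.mul_apply]
    have := h.map _ _ ih
    rwa [show z + ((a + 1 : ℕ) : ℤ) = z + a + 1 by push_cast; ring]

/-- Uniqueness of the primitive decomposition in the lower half. A suitable power of T kills the
last primitive component, so T^(e-2j) kills the sum `y` of the others, taken one degree lower;
injectivity gives `y = 0`, and induction applies. -/
theorem eq_zero_of_sum_eq_zero (h : IsLefschetz W T e) (u : ℕ → V) (j : ℕ) (hj : 2 * j ≤ e)
    (hu : ∀ p, u p ∈ primitive W T e p)
    (h0 : ∑ p ∈ Finset.range (j + 1), (T ^ (j - p)) (u p) = 0) : ∀ p ≤ j, u p = 0 := by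
  induction j with
  | zero =>
    intro p hp
    obtain rfl : p = 0 := by omega
    simpa using h0
  | succ j ih =>
    let y := ∑ p ∈ Finset.range (j + 1), (T ^ (j - p)) (u p)
    have hy : y ∈ W j := by
      refine Submodule.sum_mem _ fun p hp => ?_
      rw [Finset.mem_range] at hp
      have := h.pow_mem (j - p) (hu p).1
      rwa [show (p : ℤ) + ((j - p : ℕ) : ℤ) = j by omega] at this
    have h1 : T y + u (j + 1) = 0 := by
      rw [Finset.sum_range_succ, Nat.sub_self, pow_zero, Module.End.one_apply] at h0
      rw [← h0]
      congr 1
      rw [map_sum]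
      refine Finset.sum_congr rfl fun p hp => ?_
      rw [Finset.mem_range] at hp
      rw [← Module.End.mul_apply, ← pow_succ', show j - p + 1 = j + 1 - p by omega]
    have h2 : (T ^ (e - 2 * j)) y = 0 := by
      have h3 := congrArg (T ^ (e - 2 * (j + 1) + 1)) h1
      rw [map_add, LinearMap.mem_ker.1 (hu (j + 1)).2, map_zero, add_zero,
        ← Module.End.mul_apply, ← pow_succ] at h3
      rwa [show e - 2 * j = e - 2 * (j + 1) + 1 + 1 by omega]
    have h4 : y = 0 := h.inj j (by omega) y hy h2
    intro p hp
    rcases hp.lt_or_eq with hp | rfl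
    · exact ih (by omega) h4 p (by omega)
    · rwa [h4, map_zero, zero_add] at h1

/-- Existence of the primitive decomposition. For x of degree j + 1, surjectivity yields y of degree
j with T^(e-2j) y = T^(e-2j-1) x, and then x - T y is primitive. The upper half is the image of the
lower half. -/
theorem le_of_primitive_le (h : IsLefschetz W T e) (N : Submodule F V)
    (hN : ∀ x ∈ N, T x ∈ N) (hP : ∀ p, 2 * p ≤ e → primitive W T e p ≤ N) (z : ℤ) :
    W z ≤ N := by
  have hlow : ∀ j : ℕ, 2 * j ≤ e → W j ≤ N := by
    intro j
    induction j with
    | zero =>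
      intro _ x hx
      refine hP 0 (by omega) ⟨hx, ?_⟩
      have h1 := h.pow_mem (e - 2 * 0 + 1) hx
      rw [h.lt _ (by push_cast; omega)] at h1
      exact LinearMap.mem_ker.2 ((Submodule.mem_bot F).1 h1)
    | succ j ih =>
      intro hj x hx
      have h1 := h.pow_mem (e - 2 * (j + 1) + 1) hx
      rw [show ((j + 1 : ℕ) : ℤ) + ((e - 2 * (j + 1) + 1 : ℕ) : ℤ) = e - j by omega] at h1
      obtain ⟨y, hy, hy'⟩ := h.surj j (by omega) _ h1
      have hTy : T y ∈ W ((j + 1 : ℕ) : ℤ) := by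
        have := h.map _ _ hy
        rwa [show ((j + 1 : ℕ) : ℤ) = (j : ℤ) + 1 by push_cast; ring]
      have h2 : x - T y ∈ N := by
        refine hP (j + 1) hj ⟨Submodule.sub_mem _ hx hTy, ?_⟩
        change (T ^ (e - 2 * (j + 1) + 1)) (x - T y) = 0
        rw [map_sub, ← hy', ← Module.End.mul_apply, ← pow_succ,
          show e - 2 * (j + 1) + 1 + 1 = e - 2 * j by omega, sub_self]
      have h3 := Submodule.add_mem _ h2 (hN y (ih (by omega) hy))
      rwa [sub_add_cancel] at h3
  have hpow : ∀ (a : ℕ) (x : V), x ∈ N → (T ^ a) x ∈ N := by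
    intro a x hx
    induction a with
    | zero => simpa using hx
    | succ a ih =>
      rw [pow_succ', Module.End.mul_apply]
      exact hN _ ih
  by_cases hz : z < 0
  · rw [h.neg z hz]
    exact bot_le
  by_cases hz' : (e : ℤ) < z
  · rw [h.lt z hz']
    exact bot_le
  lift z to ℕ using by omega
  by_cases hze : 2 * z ≤ e
  · exact hlow z hze
  · intro y hy
    obtain ⟨x, hx, rfl⟩ := h.surj (e - z) (by omega) y
      (by rwa [show (e : ℤ) - ((e - z : ℕ) : ℤ) = z by omega])
    exact hpow _ _ (hlow _ (by omega) hx)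

end IsLefschetz

variable [FiniteDimensional F V]

variable (W T e) in
/-- An index set for the strings. -/
abbrev StringIndex : Type := Σ p : Fin (e / 2 + 1), Fin (Module.finrank F (primitive W T e p))

/-- The initial vector of a string. -/
def stringStart (σ : StringIndex W T e) : V :=
  (Module.finBasis F (primitive W T e σ.1) σ.2 : V)

theorem stringStart_mem (σ : StringIndex W T e) :
    stringStart σ ∈ primitive W T e σ.1 := Subtype.property _

/-- The vectors in the strings. -/
def stringVec (s : Σ σ : StringIndex W T e, Fin (e - 2 * (σ.1 : ℕ) + 1)) : V :=
  (T ^ (s.2 : ℕ)) (stringStart s.1)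

theorem map_stringStart {σ : StringIndex W T e} {a : ℕ} (ha : e - 2 * (σ.1 : ℕ) < a) :
    (T ^ a) (stringStart σ) = 0 := by
  have h := (stringStart_mem σ).2
  obtain ⟨b, rfl⟩ := Nat.exists_eq_add_of_lt ha
  rw [show e - 2 * (σ.1 : ℕ) + b + 1 = b + (e - 2 * (σ.1 : ℕ) + 1) by ring, pow_add,
    Module.End.mul_apply, LinearMap.mem_ker.1 h, map_zero]

theorem IsLefschetz.le_span_stringVec (h : IsLefschetz W T e) (z : ℤ) :
    W z ≤ Submodule.span F (Set.range (stringVec (W := W) (T := T) (e := e))) := by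
  refine h.le_of_primitive_le _ (fun x hx => ?_) (fun p hp x hx => ?_) z
  · induction hx using Submodule.span_induction with
    | mem x hx =>
      obtain ⟨⟨σ, a⟩, rfl⟩ := hx
      have h1 : T (stringVec ⟨σ, a⟩) = (T ^ ((a : ℕ) + 1)) (stringStart σ) := by
        rw [pow_succ', Module.End.mul_apply]
        rfl
      rw [h1]
      by_cases ha : (a : ℕ) + 1 < e - 2 * (σ.1 : ℕ) + 1
      · exact Submodule.subset_span ⟨⟨σ, ⟨a + 1, ha⟩⟩, rfl⟩
      · rw [map_stringStart (by omega)]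
        exact Submodule.zero_mem _
    | zero => rw [map_zero]; exact Submodule.zero_mem _
    | add x y _ _ hx hy => rw [map_add]; exact Submodule.add_mem _ hx hy
    | smul c x _ hx => rw [map_smul]; exact Submodule.smul_mem _ _ hx
  · let b := Module.finBasis F (primitive W T e p)
    have h1 := congrArg Subtype.val (b.sum_repr ⟨x, hx⟩)
    rw [AddSubmonoidClass.coe_finsetSum] at h1
    dsimp only at h1
    rw [← h1]
    refine Submodule.sum_mem _ fun β _ => Submodule.smul_mem _ _ (Submodule.subset_span ?_)
    refine ⟨⟨⟨⟨p, by omega⟩, β⟩, ⟨0, by omega⟩⟩, ?_⟩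
    simp [stringVec, stringStart, b]

/-- Independence is proved one degree at a time; in a fixed degree each string has at most one
vector, so a relation is a relation between primitive components. -/
theorem IsLefschetz.eq_zero_of_sum_stringVec (h : IsLefschetz W T e) (j : ℕ)
    (c : (Σ σ : StringIndex W T e, Fin (e - 2 * (σ.1 : ℕ) + 1)) → F)
    (hc : ∀ s, (s.1.1 : ℕ) + (s.2 : ℕ) ≠ j → c s = 0) (h0 : ∑ s, c s • stringVec s = 0) :
    c = 0 := by
  by_cases hje : e < j
  · funext s
    refine hc s ?_
    have := s.2.2
    have := s.1.1.2
    omega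
  -- A string from p to e - p passes through degree j exactly when p ≤ min(j, e - j).
  obtain ⟨J, hJ⟩ : ∃ J, J = min j (e - j) := ⟨_, rfl⟩
  let u : ℕ → V := fun p => if hp : p ≤ J then
    ∑ β, c ⟨⟨⟨p, by omega⟩, β⟩, ⟨j - p, by dsimp only; omega⟩⟩ •
      stringStart (⟨⟨p, by omega⟩, β⟩ : StringIndex W T e) else 0
  have hu : ∀ p, u p ∈ primitive W T e p := by
    intro p
    by_cases hp : p ≤ J
    · simp only [u, dif_pos hp]
      exact Submodule.sum_mem _ fun β _ => Submodule.smul_mem _ _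
        (stringStart_mem (⟨⟨p, by omega⟩, β⟩ : StringIndex W T e))
    · simp only [u, dif_neg hp]
      exact Submodule.zero_mem _
  have h1 : ∑ s, c s • stringVec s =
      ∑ p ∈ Finset.range (J + 1), (T ^ (j - p)) (u p) := by
    rw [Fintype.sum_sigma, Fintype.sum_sigma]
    have h2 : ∀ p : Fin (e / 2 + 1), ∑ β, ∑ a, c ⟨⟨p, β⟩, a⟩ • stringVec ⟨⟨p, β⟩, a⟩ =
        (T ^ (j - p)) (u p) := by
      intro p
      by_cases hp : (p : ℕ) ≤ J
      · simp only [u, dif_pos hp]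
        rw [map_sum]
        refine Finset.sum_congr rfl fun β _ => ?_
        rw [Finset.sum_eq_single ⟨j - p, by omega⟩]
        · rw [map_smul]
          rfl
        · intro a _ ha
          rw [hc, zero_smul]
          intro h'
          dsimp only at h'
          exact ha (Fin.ext (by omega : (a : ℕ) = j - p))
        · simp
      · simp only [u, dif_neg hp, map_zero]
        refine Finset.sum_eq_zero fun β _ => Finset.sum_eq_zero fun a _ => ?_
        rw [hc, zero_smul]
        have h3 := a.2
        have h4 := p.2
        dsimp only at h3 ⊢
        omega
    rw [Finset.sum_congr rfl fun p _ => h2 p,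
      Fin.sum_univ_eq_sum_range (fun p => (T ^ (j - p)) (u p))]
    symm
    refine Finset.sum_subset (Finset.range_subset_range.2 (by omega)) fun p _ hp => ?_
    rw [Finset.mem_range] at hp
    simp only [u]
    rw [dif_neg (by omega), map_zero]
  have h2 : (T ^ (j - J)) (∑ p ∈ Finset.range (J + 1), (T ^ (J - p)) (u p)) = 0 := by
    rw [← h0, h1, map_sum]
    refine Finset.sum_congr rfl fun p hp => ?_
    rw [Finset.mem_range] at hp
    rw [← Module.End.mul_apply, ← pow_add, show j - J + (J - p) = j - p by omega]
  have h3 : ∑ p ∈ Finset.range (J + 1), (T ^ (J - p)) (u p) = 0 := by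
    -- In the upper half, j - J = e - 2J, so the relation can be pulled back to degree J by
    -- injectivity.
    by_cases hj : 2 * j ≤ e
    · rw [show j - J = 0 by omega, pow_zero, Module.End.one_apply] at h2
      exact h2
    · rw [show j - J = e - 2 * J by omega] at h2
      refine h.inj J (by omega) _ (Submodule.sum_mem _ fun p hp => ?_) h2
      rw [Finset.mem_range] at hp
      have := h.pow_mem (J - p) (hu p).1
      rwa [show (p : ℤ) + ((J - p : ℕ) : ℤ) = J by omega] at this
  have h4 := h.eq_zero_of_sum_eq_zero u J (by omega) hu h3
  funext s
  by_cases hs : (s.1.1 : ℕ) + (s.2 : ℕ) = j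
  · obtain ⟨⟨⟨p, hp⟩, β⟩, ⟨a, ha⟩⟩ := s
    dsimp only at hs ha
    have hpJ : p ≤ J := by omega
    obtain rfl : a = j - p := by omega
    have h5 := h4 p hpJ
    simp only [u, dif_pos hpJ] at h5
    have h6 := (Module.finBasis F (primitive W T e p)).linearIndependent
    rw [Fintype.linearIndependent_iff] at h6
    refine h6 (fun β => c ⟨⟨⟨p, hp⟩, β⟩, ⟨j - p, ha⟩⟩) (Subtype.ext ?_) β
    rw [AddSubmonoidClass.coe_finsetSum]
    exact h5
  · exact hc s hs

end Strings

/-! ### Strings of a graded matrix -/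

section MatrixStrings

variable {F ι : Type*} [Field F] [Fintype ι] [DecidableEq ι]

/-- The vectors supported in degree `z`. -/
def supportedIn (F : Type*) [Field F] {ι : Type*} (f : ι → ℤ) (z : ℤ) : Submodule F (ι → F) where
  carrier := {x | ∀ a, f a ≠ z → x a = 0}
  zero_mem' := fun _ _ => rfl
  add_mem' := fun hx hy a ha => by rw [Pi.add_apply, hx a ha, hy a ha, add_zero]
  smul_mem' := fun c x hx a ha => by rw [Pi.smul_apply, hx a ha, smul_zero]

/-- The columns of `U` are the string vectors; in this basis `Λ` is a direct sum of nilpotent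
shifts. -/
theorem exists_strings (f : ι → ℤ) (Λ : Matrix ι ι F) (e : ℕ)
    (h : IsLefschetz (supportedIn F f) (toLin' Λ) e) :
    ∃ (S : Type) (_ : Fintype S) (_ : DecidableEq S) (p : S → ℕ)
      (U : Matrix ι (Σ σ, Fin (e - 2 * p σ + 1)) F), (∀ σ, 2 * p σ ≤ e) ∧
      (∀ m s, f m ≠ p s.1 + (s.2 : ℤ) → U m s = 0) ∧
      Λ * U = U * blockDiagonal' (fun σ => shift F (e - 2 * p σ + 1)) ∧
      ∃ U' : Matrix (Σ σ, Fin (e - 2 * p σ + 1)) ι F, U * U' = 1 ∧ U' * U = 1 := by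
  let W := supportedIn F f
  let T : Module.End F (ι → F) := toLin' Λ
  let U : Matrix ι (Σ σ : StringIndex W T e, Fin (e - 2 * (σ.1 : ℕ) + 1)) F :=
    of fun m s => stringVec s m
  have hmem : ∀ s : (Σ σ : StringIndex W T e, Fin (e - 2 * (σ.1 : ℕ) + 1)),
      stringVec s ∈ W ((s.1.1 : ℕ) + (s.2 : ℤ)) := fun s =>
    h.pow_mem _ (stringStart_mem s.1).1
  have hU : ∀ m s, f m ≠ ((s.1.1 : ℕ) : ℤ) + (s.2 : ℤ) → U m s = 0 := fun m s => hmem s m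
  have hmul : ∀ c, U *ᵥ c = ∑ s, c s • stringVec s := by
    intro c
    funext m
    simp only [mulVec, dotProduct, U, of_apply, Finset.sum_apply, Pi.smul_apply, smul_eq_mul]
    exact Finset.sum_congr rfl fun s _ => mul_comm _ _
  have hinj : Function.Injective (toLin' U) := by
    rw [injective_iff_map_eq_zero]
    intro c hc
    rw [toLin'_apply] at hc
    funext s
    let j := (s.1.1 : ℕ) + (s.2 : ℕ)
    -- Since `U` is graded, the part of a relation lying in one degree is again a relation.
    let c' : (Σ σ : StringIndex W T e, Fin (e - 2 * (σ.1 : ℕ) + 1)) → F :=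
      fun s' => if (s'.1.1 : ℕ) + (s'.2 : ℕ) = j then c s' else 0
    have h1 : c' = 0 := by
      refine h.eq_zero_of_sum_stringVec j c' (fun s' hs' => if_neg hs') ?_
      refine (hmul c').symm.trans ?_
      funext m
      by_cases hm : f m = j
      · refine Eq.trans ?_ (congrFun hc m)
        refine Finset.sum_congr rfl fun s' _ => ?_
        by_cases hs' : (s'.1.1 : ℕ) + (s'.2 : ℕ) = j
        · simp only [c', if_pos hs']
        · have h2 := hU m s' (by omega)
          dsimp only
          rw [h2, zero_mul, zero_mul]
      · refine Finset.sum_eq_zero fun s' _ => ?_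
        by_cases hs' : (s'.1.1 : ℕ) + (s'.2 : ℕ) = j
        · have h2 := hU m s' (by omega)
          dsimp only
          rw [h2, zero_mul]
        · simp only [c', if_neg hs', mul_zero]
    have h2 := congrFun h1 s
    simpa [c', j] using h2
  have hsurj : Function.Surjective (toLin' U) := by
    have hle : ∀ z, W z ≤ LinearMap.range (toLin' U) := by
      intro z
      refine (h.le_span_stringVec z).trans (Submodule.span_le.2 ?_)
      rintro _ ⟨s, rfl⟩
      refine ⟨Pi.single s 1, ?_⟩
      rw [toLin'_apply, mulVec_single_one]
      rfl
    rw [← LinearMap.range_eq_top, eq_top_iff]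
    intro x _
    rw [pi_eq_sum_univ x]
    refine Submodule.sum_mem _ fun m _ => Submodule.smul_mem _ _ (hle (f m) ?_)
    intro a ha
    exact if_neg fun h' => ha (by rw [h'])
  let E := LinearEquiv.ofBijective (toLin' U) ⟨hinj, hsurj⟩
  have hE : U = LinearMap.toMatrix' E.toLinearMap := (LinearMap.toMatrix'_toLin' U).symm
  refine ⟨StringIndex W T e, inferInstance, inferInstance, fun σ => σ.1, U, ?_, hU, ?_,
    LinearMap.toMatrix' E.symm.toLinearMap, ?_, ?_⟩
  · intro σ
    have := σ.1.2
    dsimp only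
    omega
  · ext m ⟨σ, a⟩
    have h1 : (Λ * U) m ⟨σ, a⟩ = (T ^ ((a : ℕ) + 1)) (stringStart σ) m := by
      rw [pow_succ', Module.End.mul_apply]
      rfl
    have h2 := sum_mul_shift (fun b => U m ⟨σ, b⟩) 1 a
    rw [h1, mul_apply, Fintype.sum_sigma, Finset.sum_eq_single σ]
    · simp only [blockDiagonal'_apply_eq]
      simp only [mul_one] at h2
      rw [h2]
      split_ifs with h3
      · rfl
      · rw [map_stringStart (by omega)]
        rfl
    · intro τ _ hτ
      exact Finset.sum_eq_zero fun b _ => by rw [blockDiagonal'_apply_ne _ _ _ hτ, mul_zero]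
    · simp
  · rw [hE, ← LinearMap.toMatrix'_comp, LinearEquiv.comp_symm, LinearMap.toMatrix'_id]
  · rw [hE, ← LinearMap.toMatrix'_comp, LinearEquiv.symm_comp, LinearMap.toMatrix'_id]

end MatrixStrings

/-! ### The determinants after adjoining a variable -/

section Adjoin

theorem exists_inverse_of_gram_ne_zero {F m n : Type*} [Field F] [Fintype m] [DecidableEq m]
    [Fintype n] [DecidableEq n] (X : Matrix m n F) (hc : Fintype.card m = Fintype.card n)
    (h : gram X ≠ 0) : ∃ Y : Matrix n m F, X * Y = 1 ∧ Y * X = 1 := by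
  let e := Fintype.equivOfCardEq hc
  have hdet : IsUnit (X.submatrix id e).det := by
    refine Ne.isUnit fun h0 => h ?_
    have h2 : gram X = gram (X.submatrix id e) := (gram_submatrix (Equiv.refl m) e X).symm
    rw [h2, gram_eq_sq, h0]
    ring
  refine ⟨(X.submatrix id e)⁻¹.submatrix e.symm id, ?_, ?_⟩
  · have h3 : X = (X.submatrix id e).submatrix id e.symm := by
      ext; simp
    conv_lhs => enter [1]; rw [h3]
    rw [submatrix_mul_equiv, mul_nonsing_inv _ hdet, submatrix_id_id]
  · have h3 : X = (X.submatrix id e).submatrix (Equiv.refl m) e.symm := by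
      ext; simp
    conv_lhs => enter [2]; rw [h3]
    have h4 := submatrix_mul_equiv (X.submatrix id e)⁻¹ (X.submatrix id e) e.symm
      (Equiv.refl m) e.symm
    refine h4.trans ?_
    rw [nonsing_inv_mul _ hdet, submatrix_one_equiv]

variable {F ι κ : Type*} [Field F] [Fintype ι] [DecidableEq ι] [Fintype κ]

theorem pow_apply_eq_zero {R : Type*} [CommRing R] {f : ι → ℤ} {X : Matrix ι ι R}
    (hX : ∀ a b, f a ≠ f b + 1 → X a b = 0)
    (t : ℕ) (a b : ι) (h : f a ≠ f b + t) : (X ^ t) a b = 0 := by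
  induction t generalizing b with
  | zero =>
    rw [pow_zero, one_apply_ne]
    rintro rfl
    simp at h
  | succ t ih =>
    rw [pow_succ, mul_apply]
    refine Finset.sum_eq_zero fun c _ => ?_
    by_cases hc : f c = f b + 1
    · rw [ih c (by push_cast at h; omega), zero_mul]
    · rw [hX c b hc, mul_zero]

theorem mul_pow_eq {R : Type*} [CommRing R] [DecidableEq κ] {X : Matrix ι ι R} {U : Matrix ι κ R}
    {K : Matrix κ κ R} (h : X * U = U * K) (t : ℕ) : X ^ t * U = U * K ^ t := by
  induction t with
  | zero => simp
  | succ t ih =>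
    rw [pow_succ, Matrix.mul_assoc, h, ← Matrix.mul_assoc, ih, Matrix.mul_assoc, pow_succ]

theorem mulVec_eq_block_mulVec {R ι κ : Type*} [Fintype κ] [CommRing R] (f : ι → ℤ) (g : κ → ℤ) (X : Matrix ι κ R)
    (p q : ℤ) (x : κ → R) (hx : ∀ b, g b ≠ q → x b = 0) (a : {a // f a = p}) :
    (X *ᵥ x) a = (block f g X p q *ᵥ fun b => x b) a := by
  simp only [mulVec, dotProduct, block, submatrix_apply]
  rw [← Finset.sum_subtype (Finset.univ.filter fun b => g b = q) (by simp)
    (fun b => X a b * x b), Finset.sum_filter_of_ne]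
  intro b _ hb
  by_contra hne
  exact hb (by rw [hx b hne, mul_zero])

theorem isLefschetz_of_gram {f : ι → ℤ} {Λ : Matrix ι ι F} {e : ℕ}
    (hf : ∀ a, 0 ≤ f a ∧ f a ≤ e) (hΛ : ∀ a b, f a ≠ f b + 1 → Λ a b = 0)
    (hcard : ∀ p : ℕ, 2 * p ≤ e →
      Fintype.card {a // f a = (e : ℤ) - p} = Fintype.card {a // f a = (p : ℤ)})
    (hG : ∀ p : ℕ, 2 * p ≤ e → gram (block f f (Λ ^ (e - 2 * p)) (e - p) p) ≠ 0) :
    IsLefschetz (supportedIn F f) (toLin' Λ) e where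
  map := by
    intro z x hx a ha
    rw [toLin'_apply]
    refine Finset.sum_eq_zero fun b _ => ?_
    by_cases hb : f b = z
    · have := hΛ a b (by omega)
      dsimp only
      rw [this, zero_mul]
    · rw [hx b hb, mul_zero]
  inj := by
    intro p hp x hx h0
    obtain ⟨Y, -, hY⟩ := exists_inverse_of_gram_ne_zero _ (hcard p hp) (hG p hp)
    rw [← toLin'_pow, toLin'_apply] at h0
    have h1 : (block f f (Λ ^ (e - 2 * p)) (e - p) p *ᵥ fun b => x b) = 0 := by
      funext a
      rw [← mulVec_eq_block_mulVec f f (Λ ^ (e - 2 * p)) (e - p) p x hx a, h0]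
      rfl
    have h2 := congrArg (Y *ᵥ ·) h1
    simp only [mulVec_mulVec, hY, one_mulVec, mulVec_zero] at h2
    funext a
    by_cases ha : f a = p
    · exact congrFun h2 ⟨a, ha⟩
    · exact hx a ha
  surj := by
    intro p hp y hy
    obtain ⟨Y, hY, -⟩ := exists_inverse_of_gram_ne_zero _ (hcard p hp) (hG p hp)
    let x' := Y *ᵥ fun b => y b
    let x : ι → F := fun a => if ha : f a = p then x' ⟨a, ha⟩ else 0
    have hx : x ∈ supportedIn F f p := fun a ha => dif_neg ha
    have hx' : (fun b : {b // f b = (p : ℤ)} => x b) = x' := by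
      funext b
      exact dif_pos b.2
    refine ⟨x, hx, ?_⟩
    rw [← toLin'_pow, toLin'_apply]
    funext a
    by_cases ha : f a = (e : ℤ) - p
    · have h1 := mulVec_eq_block_mulVec f f (Λ ^ (e - 2 * p)) (e - p) p x hx ⟨a, ha⟩
      rw [h1, hx', mulVec_mulVec, hY, one_mulVec]
    · rw [hy a ha]
      refine Finset.sum_eq_zero fun b _ => ?_
      by_cases hb : f b = p
      · have := pow_apply_eq_zero hΛ (e - 2 * p) a b (by omega)
        dsimp only
        rw [this, zero_mul]
      · rw [hx b hb, mul_zero]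
  neg := by
    intro z hz
    rw [eq_bot_iff]
    intro x hx
    refine (Submodule.mem_bot F).2 (funext fun a => hx a ?_)
    have := hf a
    omega
  lt := by
    intro z hz
    rw [eq_bot_iff]
    intro x hx
    refine (Submodule.mem_bot F).2 (funext fun a => hx a ?_)
    have := hf a
    omega

/-- The inverse is not assumed to be graded. Its degree-preserving part `Y` is already a right
inverse of `U`, so the two coincide, and inversion can be done degree by degree. -/
theorem block_mul_block_eq_one {R : Type*} [CommRing R] [DecidableEq κ] {f : ι → ℤ} {g : κ → ℤ}
    {U : Matrix ι κ R} {U' : Matrix κ ι R} (hU : ∀ a b, f a ≠ g b → U a b = 0) (h1 : U * U' = 1)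
    (h2 : U' * U = 1) (z : ℤ) :
    block f g U z z * block g f U' z z = 1 ∧ block g f U' z z * block f g U z z = 1 := by
  let Y : Matrix κ ι R := of fun b a => if g b = f a then U' b a else 0
  have h3 : U * Y = 1 := by
    ext a a'
    rw [← h1, mul_apply, mul_apply]
    by_cases ha : f a = f a'
    · refine Finset.sum_congr rfl fun b _ => ?_
      by_cases hb : f a = g b
      · simp only [Y, of_apply, if_pos (hb.symm.trans ha)]
      · rw [hU a b hb, zero_mul, zero_mul]
    · refine Eq.trans ?_ ((congrFun₂ h1 a a').trans (one_apply_ne fun h => ha (by rw [h]))).symm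
      refine Finset.sum_eq_zero fun b _ => ?_
      by_cases hb : f a = g b
      · simp only [Y, of_apply]
        rw [if_neg fun h => ha (hb.trans h), mul_zero]
      · rw [hU a b hb, zero_mul]
  have h4 : U' = Y := by
    rw [← Matrix.mul_one U', ← h3, ← Matrix.mul_assoc, h2, Matrix.one_mul]
  constructor
  · rw [← block_mul, h1, block_one]
    intro b a ha hb
    rw [h4]
    exact if_neg fun h => hb (h.trans ha)
  · rw [← block_mul, h2, block_one]
    intro a b hb ha
    exact hU a b fun h => ha (h.trans hb)

theorem shift_pow_apply {R : Type*} [CommRing R] (q t : ℕ) (a b : Fin q) :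
    (shift R q ^ t) a b = if (a : ℕ) = b + t then 1 else 0 := by
  induction t generalizing b with
  | zero => simp [one_apply, Fin.ext_iff]
  | succ t ih =>
    have h := sum_mul_shift (fun c => (shift R q ^ t) a c) 1 b
    simp only [mul_one] at h
    rw [pow_succ, mul_apply, h]
    split_ifs with h1 h2 h2
    · rw [ih, if_pos (by dsimp only; omega)]
    · rw [ih, if_neg (by dsimp only; omega)]
    · omega
    · rfl

/-- A string has at most one vector in each degree, so the block is empty or is the 1 × 1 matrix 1.
-/
theorem gram_shift_pow {R : Type*} [CommRing R] (e p q : ℕ) (hp : 2 * p ≤ e) (hq : 2 * q ≤ e) :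
    gram (block (fun a : Fin (e - 2 * p + 1) => (p : ℤ) + (a : ℤ))
      (fun a : Fin (e - 2 * p + 1) => (p : ℤ) + (a : ℤ)) (shift R _ ^ (e - 2 * q)) (e - q) q) =
      1 := by
  by_cases h : q < p
  · refine gram_block_eq_one_of_isEmpty _ _ _ _ fun a => ?_
    omega
  · let u : Unit ≃ {a : Fin (e - 2 * p + 1) // (p : ℤ) + (a : ℤ) = e - q} :=
      { toFun := fun _ => ⟨⟨e - q - p, by omega⟩, by dsimp only; omega⟩
        invFun := fun _ => ()
        left_inv := fun _ => rfl
        right_inv := fun a => Subtype.ext (Fin.ext (by have := a.2; dsimp only; omega)) }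
    let v : Unit ≃ {a : Fin (e - 2 * p + 1) // (p : ℤ) + (a : ℤ) = q} :=
      { toFun := fun _ => ⟨⟨q - p, by omega⟩, by dsimp only; omega⟩
        invFun := fun _ => ()
        left_inv := fun _ => rfl
        right_inv := fun a => Subtype.ext (Fin.ext (by have := a.2; dsimp only; omega)) }
    rw [← gram_submatrix u v, ← gram_one (R := R) (n := Unit)]
    congr 1
    ext
    simp only [submatrix_apply, block, shift_pow_apply, one_apply_eq]
    refine if_pos ?_
    change e - q - p = q - p + (e - 2 * q)
    omega

/-- The degree of a pair of which the second component is an exponent of a new variable. -/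
def adjoinDeg (f : ι → ℤ) (d : ℕ) (x : ι × Fin d) : ℤ := f x.1 + (x.2 : ℤ)

/-- The multiplication by the sum of the variables after adjoining a variable. -/
def adjoinMul {R ι : Type*} [CommRing R] [DecidableEq ι] (Λ : Matrix ι ι R) (d : ℕ) :
    Matrix (ι × Fin d) (ι × Fin d) R := Λ ⊗ₖ 1 + 1 ⊗ₖ shift R d

theorem adjoinMul_apply_eq_zero {R ι : Type*} [CommRing R] [DecidableEq ι] {f : ι → ℤ} {Λ : Matrix ι ι R}
    (hΛ : ∀ a b, f a ≠ f b + 1 → Λ a b = 0) (d : ℕ) (x y : ι × Fin d)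
    (h : adjoinDeg f d x ≠ adjoinDeg f d y + 1) : adjoinMul Λ d x y = 0 := by
  obtain ⟨a, j⟩ := x
  obtain ⟨b, l⟩ := y
  simp only [adjoinDeg] at h
  simp only [adjoinMul, Matrix.add_apply, kroneckerMap_apply]
  have h1 : Λ a b * (1 : Matrix (Fin d) (Fin d) R) j l = 0 := by
    by_cases hjl : j = l
    · subst hjl
      rw [hΛ a b (by omega), zero_mul]
    · rw [one_apply_ne hjl, mul_zero]
  have h2 : (1 : Matrix ι ι R) a b * shift R d j l = 0 := by
    by_cases hab : a = b
    · subst hab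
      rw [shift, of_apply, if_neg (by omega), mul_zero]
    · rw [one_apply_ne hab, zero_mul]
  rw [h1, h2, add_zero]

theorem submatrix_equiv_pow {R : Type*} [CommRing R] [DecidableEq κ] (X : Matrix ι ι R) (e : κ ≃ ι)
    (t : ℕ) : X.submatrix e e ^ t = (X ^ t).submatrix e e := by
  induction t with
  | zero => simp
  | succ t ih => rw [pow_succ, ih, submatrix_mul_equiv, pow_succ]

theorem adjoinMul_blockDiagonal' {R S : Type*} [CommRing R] [Fintype S] [DecidableEq S]
    (q : S → ℕ) (d : ℕ) :
    adjoinMul (blockDiagonal' fun σ => shift R (q σ)) d =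
      (blockDiagonal' fun σ => twoShift R (q σ) d).submatrix
        (Equiv.sigmaProdDistrib (fun σ => Fin (q σ)) (Fin d))
        (Equiv.sigmaProdDistrib (fun σ => Fin (q σ)) (Fin d)) := by
  ext ⟨⟨σ, a⟩, j⟩ ⟨⟨τ, b⟩, l⟩
  simp only [adjoinMul, Matrix.add_apply, kroneckerMap_apply, submatrix_apply,
    Equiv.sigmaProdDistrib_apply]
  by_cases h : σ = τ
  · subst h
    simp [twoShift, kroneckerMap_apply, one_apply]
  · simp [blockDiagonal'_apply_ne _ _ _ h, one_apply, h]

/-- Reflecting j ↦ d - 1 - j turns i + t - j into e - (i - j). For j < d - t a second reflection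
matches the factors on both sides. Each other j contributes `b j` if j ≤ i and 1 if j > i, where the
degrees are out of range. Truncated subtraction makes `d - t` the maximum of 0 and d - t. -/
theorem prod_reflect_eq (g : ℤ → ℚ) (b : ℕ → ℚ) (i t e d : ℕ) (hd : 1 ≤ d)
    (he : 2 * i + t = e + (d - 1))
    (hneg : ∀ z, z < 0 → g z = 1) (hlt : ∀ z, (e : ℤ) < z → g z = 1)
    (hb : ∀ j ∈ Finset.Icc (d - t) (min i (d - 1)), b j * g (i - j) = g (e - (i - j))) :
    ∏ j ∈ Finset.range d, g (i + t - j) =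
      (∏ j ∈ Finset.range d, g (i - j)) * ∏ j ∈ Finset.Icc (d - t) (min i (d - 1)), b j := by
  have h1 : ∏ j ∈ Finset.range d, g (i + t - j) =
      ∏ j ∈ Finset.range d, g (e - (i - j)) := by
    rw [← Finset.prod_range_reflect]
    refine Finset.prod_congr rfl fun j hj => ?_
    rw [Finset.mem_range] at hj
    exact congrArg g (by omega)
  have h2 : ∏ j ∈ Finset.range (d - t), g (e - (i - j)) =
      ∏ j ∈ Finset.range (d - t), g (i - j) := by
    rw [← Finset.prod_range_reflect]
    refine Finset.prod_congr rfl fun j hj => ?_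
    rw [Finset.mem_range] at hj
    exact congrArg g (by omega)
  have h3 : ∏ j ∈ Finset.Ico (d - t) d, g (e - (i - j)) =
      (∏ j ∈ Finset.Ico (d - t) d, g (i - j)) * ∏ j ∈ Finset.Icc (d - t) (min i (d - 1)), b j := by
    have h4 : Finset.Icc (d - t) (min i (d - 1)) = (Finset.Ico (d - t) d).filter (· ≤ i) := by
      ext j
      simp only [Finset.mem_Icc, Finset.mem_filter, Finset.mem_Ico]
      omega
    rw [h4, Finset.prod_filter, ← Finset.prod_mul_distrib]
    refine Finset.prod_congr rfl fun j hj => ?_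
    rw [Finset.mem_Ico] at hj
    split_ifs with hji
    · rw [mul_comm, hb]
      rw [Finset.mem_Icc]
      omega
    · rw [hneg (i - j) (by omega), hlt _ (by omega), one_mul]
  rw [h1, ← Finset.prod_range_mul_prod_Ico _ (Nat.sub_le d t), h2, h3, ← mul_assoc,
    Finset.prod_range_mul_prod_Ico _ (Nat.sub_le d t)]

/-- The recursion for the squares of the Lefschetz determinants. -/
theorem gram_adjoinMul_pow {f : ι → ℤ} {Λ : Matrix ι ι ℚ} {e : ℕ}
    (hf : ∀ a, 0 ≤ f a ∧ f a ≤ e) (hΛ : ∀ a b, f a ≠ f b + 1 → Λ a b = 0)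
    (hcard : ∀ p : ℕ, 2 * p ≤ e →
      Fintype.card {a // f a = (e : ℤ) - p} = Fintype.card {a // f a = (p : ℤ)})
    (hG : ∀ p : ℕ, 2 * p ≤ e → gram (block f f (Λ ^ (e - 2 * p)) (e - p) p) ≠ 0)
    (i t d : ℕ) (hd : 1 ≤ d) (he : 2 * i + t = e + (d - 1))
    (hcard' : Fintype.card {x // adjoinDeg f d x = (i : ℤ) + t} =
      Fintype.card {x // adjoinDeg f d x = (i : ℤ)}) :
    gram (block (adjoinDeg f d) (adjoinDeg f d) (adjoinMul Λ d ^ t) (i + t) i) =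
      (∏ j ∈ Finset.Icc (d - t) (min i (d - 1)),
        gram (block f f (Λ ^ (e - 2 * (i - j))) (e - (i - j : ℕ)) (i - j : ℕ))) *
      ∏ s ∈ Finset.Icc (max 1 (d - i - 1)) (min (t - 1) (d - 1)),
        (((matC t s d).det : ℚ) ^ 2) ^
          ((Fintype.card {a // f a = (i : ℤ) + s - (d - 1)} : ℤ) -
            Fintype.card {a // f a = (i : ℤ) + s - d}) := by
  obtain ⟨S, _, _, p, U, hp, hU, hUJ, U', hUU', hU'U⟩ :=
    exists_strings f Λ e (isLefschetz_of_gram hf hΛ hcard hG)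
  let sdeg : (Σ σ, Fin (e - 2 * p σ + 1)) → ℤ := fun s => p s.1 + (s.2 : ℤ)
  have hblock := fun z => block_mul_block_eq_one (g := sdeg) hU hUU' hU'U z
  have hcardU : ∀ z, Fintype.card {a // f a = z} = Fintype.card {s // sdeg s = z} := fun z =>
    square_of_invertible _ _ (hblock z).1 (hblock z).2
  -- The squared determinant of the base change in degree z; these factors cancel except for the
  -- smaller Lefschetz determinants.
  let g : ℤ → ℚ := fun z => gram (block f sdeg U z z)
  have hg : ∀ z, g z ≠ 0 := by
    intro z h0
    have h1 := gram_mul (block f sdeg U z z) (block sdeg f U' z z) (hcardU z)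
    rw [(hblock z).1, gram_one] at h1
    rw [show gram (block f sdeg U z z) = 0 from h0, zero_mul] at h1
    exact one_ne_zero h1
  let J := blockDiagonal' fun σ => shift ℚ (e - 2 * p σ + 1)
  have hJ : ∀ x y, sdeg x ≠ sdeg y + 1 → J x y = 0 := by
    rintro ⟨σ, a⟩ ⟨τ, b⟩ h
    by_cases hστ : σ = τ
    · subst hστ
      simp only [sdeg] at h
      simp only [J, blockDiagonal'_apply_eq, shift, of_apply]
      exact if_neg (by omega)
    · exact blockDiagonal'_apply_ne _ _ _ hστ
  -- the determinants for `Λ` in terms of the change of basis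
  have hA : ∀ z : ℕ, 2 * z ≤ e →
      gram (block f f (Λ ^ (e - 2 * z)) (e - z) z) * g z = g (e - z) := by
    intro z hz
    have h1 : block f sdeg (Λ ^ (e - 2 * z) * U) (e - z) z =
        block f f (Λ ^ (e - 2 * z)) (e - z) z * block f sdeg U z z :=
      block_mul fun a s hs ha => hU a s fun h => ha (h.trans hs)
    have h2 : block f sdeg (U * J ^ (e - 2 * z)) (e - z) z =
        block f sdeg U (e - z) (e - z) * block sdeg sdeg (J ^ (e - 2 * z)) (e - z) z :=
      block_mul fun a s hs ha => pow_apply_eq_zero hJ _ a s (by omega)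
    rw [mul_pow_eq hUJ, h2] at h1
    have h3 := congrArg gram h1
    rw [gram_mul _ _ (hcardU _), gram_mul _ _ (hcard z hz)] at h3
    rw [← h3]
    have h4 : gram (block sdeg sdeg (J ^ (e - 2 * z)) (e - z) z) = 1 := by
      rw [← blockDiagonal'_pow, gram_block_blockDiagonal']
      exact Finset.prod_eq_one fun σ _ => gram_shift_pow e (p σ) z (hp σ) hz
    rw [h4, mul_one]
  -- the determinants after adjoining a variable
  let K := adjoinMul J d
  have hUK : adjoinMul Λ d * (U ⊗ₖ (1 : Matrix (Fin d) (Fin d) ℚ)) =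
      (U ⊗ₖ (1 : Matrix (Fin d) (Fin d) ℚ)) * K := by
    simp only [K, adjoinMul]
    rw [Matrix.add_mul, Matrix.mul_add, ← mul_kronecker_mul, ← mul_kronecker_mul,
      ← mul_kronecker_mul, ← mul_kronecker_mul, hUJ]
    simp
    rfl
  -- The base change `U ⊗ₖ 1` intertwines the two multiplications; take Gram determinants on both
  -- sides and split those of `U ⊗ₖ 1` by powers of x.
  have hB : gram (block (adjoinDeg f d) (adjoinDeg f d) (adjoinMul Λ d ^ t) (i + t) i) *
      ∏ j ∈ Finset.range d, g (i - j) = (∏ j ∈ Finset.range d, g (i + t - j)) *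
        gram (block (adjoinDeg sdeg d) (adjoinDeg sdeg d) (K ^ t) (i + t) i) := by
    have hU1 : ∀ x y, adjoinDeg f d x ≠ adjoinDeg sdeg d y →
        (U ⊗ₖ (1 : Matrix (Fin d) (Fin d) ℚ)) x y = 0 := by
      rintro ⟨a, j⟩ ⟨s, l⟩ h
      simp only [adjoinDeg] at h
      rw [kroneckerMap_apply]
      by_cases hjl : j = l
      · subst hjl
        rw [hU a s (fun h' => h (by rw [h'])), zero_mul]
      · dsimp only
        rw [one_apply_ne hjl, mul_zero]
    have hcard1 : ∀ z, Fintype.card {x // adjoinDeg f d x = z} =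
        Fintype.card {x // adjoinDeg sdeg d x = z} := by
      intro z
      have h1 : (U ⊗ₖ (1 : Matrix (Fin d) (Fin d) ℚ)) *
          (U' ⊗ₖ (1 : Matrix (Fin d) (Fin d) ℚ)) = 1 := by
        rw [← mul_kronecker_mul, hUU', Matrix.one_mul, one_kronecker_one]
      have h2 : (U' ⊗ₖ (1 : Matrix (Fin d) (Fin d) ℚ)) *
          (U ⊗ₖ (1 : Matrix (Fin d) (Fin d) ℚ)) = 1 := by
        rw [← mul_kronecker_mul, hU'U, Matrix.one_mul, one_kronecker_one]
      have h3 := block_mul_block_eq_one hU1 h1 h2 z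
      exact square_of_invertible _ _ h3.1 h3.2
    have h1 : block (adjoinDeg f d) (adjoinDeg sdeg d) (adjoinMul Λ d ^ t *
        (U ⊗ₖ (1 : Matrix (Fin d) (Fin d) ℚ))) (i + t) i =
        block (adjoinDeg f d) (adjoinDeg f d) (adjoinMul Λ d ^ t) (i + t) i *
        block (adjoinDeg f d) (adjoinDeg sdeg d) (U ⊗ₖ (1 : Matrix (Fin d) (Fin d) ℚ)) i i :=
      block_mul fun x y hy hx => hU1 x y fun h => hx (h.trans hy)
    have h2 : block (adjoinDeg f d) (adjoinDeg sdeg d)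
        ((U ⊗ₖ (1 : Matrix (Fin d) (Fin d) ℚ)) * K ^ t) (i + t) i =
        block (adjoinDeg f d) (adjoinDeg sdeg d) (U ⊗ₖ (1 : Matrix (Fin d) (Fin d) ℚ))
          (i + t) (i + t) *
        block (adjoinDeg sdeg d) (adjoinDeg sdeg d) (K ^ t) (i + t) i :=
      block_mul fun x y hy hx =>
        pow_apply_eq_zero (adjoinMul_apply_eq_zero hJ d) _ x y (by omega)
    rw [mul_pow_eq hUK, h2] at h1
    have h3 := congrArg gram h1
    rw [gram_mul _ _ (hcard1 _), gram_mul _ _ hcard'] at h3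
    have h4 := fun z => gram_block_kronecker_one (d := d) f sdeg U z
    exact ((congrArg _ (h4 i)).symm.trans h3.symm).trans (congrArg (· * _) (h4 (i + t)))
  have hK : gram (block (adjoinDeg sdeg d) (adjoinDeg sdeg d) (K ^ t) (i + t) i) =
      ∏ σ, if p σ + (d - 1) - i ∈ Finset.Icc (max 1 (d - i - 1)) (min (t - 1) (d - 1)) then
        ((matC t (p σ + (d - 1) - i) d).det : ℚ) ^ 2 else 1 := by
    have h1 : K = (blockDiagonal' fun σ => twoShift ℚ (e - 2 * p σ + 1) d).submatrix _ _ :=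
      adjoinMul_blockDiagonal' _ d
    rw [h1, submatrix_equiv_pow, ← blockDiagonal'_pow]
    let deg : (Σ σ, Fin (e - 2 * p σ + 1) × Fin d) → ℤ :=
      fun x => (p x.1 : ℤ) + (x.2.1 : ℤ) + (x.2.2 : ℤ)
    refine (gram_block_submatrix _ _ deg deg _ _ _).trans ?_
    rw [gram_block_blockDiagonal']
    exact Finset.prod_congr rfl fun σ _ => gram_string e i t d (p σ) hd he (hp σ)
  have hC : ∀ z : ℤ, 2 * z ≤ e →
      (Fintype.card {a // f a = z} : ℤ) - Fintype.card {a // f a = z - 1} =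
        (Finset.univ.filter fun σ => (p σ : ℤ) = z).card := by
    -- In the lower half every string that has started is still alive, so the dimension counts the
    -- strings starting in degree at most z.
    have h1 : ∀ z : ℤ, 2 * z ≤ e → Fintype.card {a // f a = z} =
        (Finset.univ.filter fun σ => (p σ : ℤ) ≤ z).card := by
      intro z hz
      rw [hcardU, ← Fintype.card_subtype]
      refine Fintype.card_congr
        { toFun := fun s => ⟨s.1.1, by have := s.2; simp only [sdeg] at this; omega⟩
          invFun := fun σ => ⟨⟨σ.1, ⟨(z - p σ.1).toNat, by have := σ.2; omega⟩⟩, by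
            have := σ.2
            simp only [sdeg]
            omega⟩
          left_inv := ?_
          right_inv := fun σ => rfl }
      rintro ⟨⟨σ, a⟩, hs⟩
      apply Subtype.ext
      simp only [sdeg] at hs
      refine Sigma.ext rfl (heq_of_eq (Fin.ext ?_))
      dsimp only
      omega
    intro z hz
    rw [h1 z hz, h1 (z - 1) (by omega), sub_eq_iff_eq_add, ← Nat.cast_add,
      ← Finset.card_union_of_disjoint]
    · congr 2
      ext σ
      simp only [Finset.mem_filter, Finset.mem_univ, true_and, Finset.mem_union]
      omega
    · rw [Finset.disjoint_filter]
      intro σ _ h h'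
      omega
  have hW : (∏ σ, if p σ + (d - 1) - i ∈ Finset.Icc (max 1 (d - i - 1)) (min (t - 1) (d - 1)) then
        ((matC t (p σ + (d - 1) - i) d).det : ℚ) ^ 2 else 1) =
      ∏ s ∈ Finset.Icc (max 1 (d - i - 1)) (min (t - 1) (d - 1)),
        (((matC t s d).det : ℚ) ^ 2) ^
          ((Fintype.card {a // f a = (i : ℤ) + s - (d - 1)} : ℤ) -
            Fintype.card {a // f a = (i : ℤ) + s - d}) := by
    -- Group the strings by s; those with a given s start in degree i + s - (d - 1), and this degree
    -- lies in the lower half because s ≤ t - 1 and s ≤ d - 1.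
    rw [← Finset.prod_filter, ← Finset.prod_fiberwise_of_maps_to
      (g := fun σ => p σ + (d - 1) - i) (t := Finset.Icc (max 1 (d - i - 1)) (min (t - 1) (d - 1)))
      (fun σ hσ => (Finset.mem_filter.1 hσ).2)]
    refine Finset.prod_congr rfl fun s hs => ?_
    rw [Finset.prod_congr rfl (g := fun _ => ((matC t s d).det : ℚ) ^ 2)
      (fun σ hσ => by rw [(Finset.mem_filter.1 hσ).2]), Finset.prod_const]
    have h1 := hC ((i : ℤ) + s - (d - 1)) (by rw [Finset.mem_Icc] at hs; omega)
    rw [show (i : ℤ) + s - (d - 1) - 1 = i + s - d by ring] at h1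
    rw [h1, zpow_natCast]
    congr 2
    ext σ
    rw [Finset.mem_Icc] at hs
    simp only [Finset.mem_filter, Finset.mem_univ, true_and, Finset.mem_Icc]
    omega
  have hR := prod_reflect_eq g
    (fun j => gram (block f f (Λ ^ (e - 2 * (i - j))) (e - (i - j : ℕ)) (i - j : ℕ))) i t e d hd he
    (fun z hz => gram_block_eq_one_of_isEmpty _ _ _ _ fun a => by have := hf a; omega)
    (fun z hz => gram_block_eq_one_of_isEmpty _ _ _ _ fun a => by have := hf a; omega)
    (fun j hj => by
      rw [Finset.mem_Icc] at hj
      have h1 := hA (i - j) (by omega)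
      rwa [Nat.cast_sub (by omega)] at h1 ⊢)
  have hne : ∏ j ∈ Finset.range d, g (i - j) ≠ 0 := Finset.prod_ne_zero_iff.2 fun j _ => hg _
  rw [hK, hW, hR, mul_comm _ (∏ j ∈ Finset.range d, g (i - j)), mul_assoc] at hB
  exact mul_left_cancel₀ hne hB

end Adjoin

/-! ### The matrix of the multiplication by the sum of the variables -/

section Lam

/-- The matrix of the multiplication by `x_1 + ⋯ + x_n` in the monomial basis of `A`. -/
def lam (R : Type*) [CommRing R] {n : ℕ} (d : Fin n → ℕ) :
    Matrix ((j : Fin n) → Fin (d j)) ((j : Fin n) → Fin (d j)) R :=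
  of fun m' m => ∑ j, if ∀ l, (m' l : ℕ) = m l + if l = j then 1 else 0 then 1 else 0

/-- The degree of a monomial. -/
def expoDeg {n : ℕ} (d : Fin n → ℕ) (m : (j : Fin n) → Fin (d j)) : ℤ := ∑ j, ((m j : ℕ) : ℤ)

variable {n : ℕ} (d : Fin n → ℕ)

theorem lam_apply_eq_zero {R : Type*} [CommRing R] (m' m : (j : Fin n) → Fin (d j))
    (h : expoDeg d m' ≠ expoDeg d m + 1) : lam R d m' m = 0 := by
  rw [lam, of_apply]
  refine Finset.sum_eq_zero fun j _ => if_neg fun h' => h ?_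
  have h1 : ∑ l : Fin n, ((if l = j then 1 else 0 : ℕ) : ℤ) = 1 := by simp
  rw [expoDeg, expoDeg, ← h1, ← Finset.sum_add_distrib]
  exact Finset.sum_congr rfl fun l _ => by rw [h' l, Nat.cast_add]

theorem lam_map {R S : Type*} [CommRing R] [CommRing S] (φ : R →+* S) :
    (lam R d).map φ = lam S d := by
  ext m' m
  simp only [lam, map_apply, of_apply, map_sum]
  exact Finset.sum_congr rfl fun j _ => by split_ifs <;> simp

theorem lam_pow_map {R S : Type*} [CommRing R] [CommRing S] (φ : R →+* S) (t : ℕ) :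
    (lam R d ^ t).map φ = lam S d ^ t := by
  rw [← RingHom.mapMatrix_apply, map_pow, RingHom.mapMatrix_apply, lam_map]

theorem adjoinMul_apply {R ι : Type*} [CommRing R] [DecidableEq ι] (Λ : Matrix ι ι R) (d : ℕ)
    (a b : ι) (j l : Fin d) : adjoinMul Λ d (a, j) (b, l) =
      Λ a b * (if j = l then 1 else 0) +
        (if a = b then 1 else 0) * if (j : ℕ) = l + 1 then 1 else 0 := by
  simp only [adjoinMul, Matrix.add_apply, kroneckerMap_apply, one_apply, shift, of_apply]

/-- The exponents of all variables are those of the first ones together with the last one. -/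
def expoEquiv (d : Fin (n + 1) → ℕ) :
    ((j : Fin (n + 1)) → Fin (d j)) ≃ ((j : Fin n) → Fin (Fin.init d j)) × Fin (d (Fin.last n)) :=
  (Fin.snocEquiv fun j => Fin (d j)).symm.trans (Equiv.prodComm _ _)

theorem expoDeg_eq (d : Fin (n + 1) → ℕ) :
    expoDeg d = adjoinDeg (expoDeg (Fin.init d)) (d (Fin.last n)) ∘ expoEquiv d := by
  funext m
  exact Fin.sum_univ_castSucc _

theorem lam_eq (R : Type*) [CommRing R] (d : Fin (n + 1) → ℕ) :
    lam R d = (adjoinMul (lam R (Fin.init d)) (d (Fin.last n))).submatrix (expoEquiv d)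
      (expoEquiv d) := by
  ext m' m
  refine Eq.trans ?_ (adjoinMul_apply _ _ (expoEquiv d m').1 (expoEquiv d m).1
    (expoEquiv d m').2 (expoEquiv d m).2).symm
  rw [lam, of_apply, Fin.sum_univ_castSucc]
  congr 1
  · rw [lam, of_apply, Finset.sum_mul]
    refine Finset.sum_congr rfl fun j _ => ?_
    rw [ite_zero_mul_ite_zero, mul_one]
    refine if_congr ?_ rfl rfl
    rw [Fin.forall_fin_succ']
    simp only [Fin.ext_iff, Fin.val_castSucc, Fin.val_last, j.2.ne', if_false, add_zero]
    exact Iff.rfl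
  · rw [ite_zero_mul_ite_zero, mul_one]
    refine if_congr ?_ rfl rfl
    rw [Fin.forall_fin_succ']
    simp only [funext_iff, Fin.ext_iff, Fin.val_castSucc, Fin.val_last, Fin.is_lt, ne_of_lt, if_false,
      if_true, add_zero]
    exact Iff.rfl

theorem expoDeg_mem (m : (j : Fin n) → Fin (d j)) :
    0 ≤ expoDeg d m ∧ expoDeg d m ≤ socleDegree d := by
  have h := sum_rev m
  simp only [expoDeg]
  rw [← Nat.cast_sum]
  omega

theorem card_expoDeg (i : ℕ) :
    Fintype.card {m // expoDeg d m = i} = Fintype.card (Expo d i) := by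
  refine Fintype.card_congr (Equiv.subtypeEquivRight fun m => ?_)
  rw [expoDeg, ← Nat.cast_sum, Nat.cast_inj]

theorem card_expoDeg_symm (i t : ℕ) (h : 2 * i + t = socleDegree d) :
    Fintype.card {m // expoDeg d m = (i : ℤ) + t} =
      Fintype.card {m // expoDeg d m = (i : ℤ)} := by
  have h1 := card_expoDeg d (i + t)
  rw [Nat.cast_add] at h1
  rw [h1, card_expoDeg, Fintype.card_congr (complEquiv d i t h)]

theorem socleDegree_eq (d : Fin (n + 1) → ℕ) :
    socleDegree d = socleDegree (Fin.init d) + (d (Fin.last n) - 1) :=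
  Fin.sum_univ_castSucc _

theorem gram_lam_pow_eq (d : Fin (n + 1) → ℕ) (hd : ∀ j, 1 ≤ d j)
    (hG : ∀ i t : ℕ, 2 * i + t = socleDegree (Fin.init d) →
      gram (block (expoDeg (Fin.init d)) (expoDeg (Fin.init d))
        (lam ℚ (Fin.init d) ^ t) (i + t) i) ≠ 0)
    (i t : ℕ) (h : 2 * i + t = socleDegree d) :
    gram (block (expoDeg d) (expoDeg d) (lam ℚ d ^ t) (i + t) i) =
      (∏ j ∈ Finset.Icc (d (Fin.last n) - t) (min i (d (Fin.last n) - 1)),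
        gram (block (expoDeg (Fin.init d)) (expoDeg (Fin.init d))
          (lam ℚ (Fin.init d) ^ (socleDegree (Fin.init d) - 2 * (i - j)))
          (socleDegree (Fin.init d) - (i - j : ℕ)) (i - j : ℕ))) *
      ∏ s ∈ Finset.Icc (max 1 (d (Fin.last n) - i - 1)) (min (t - 1) (d (Fin.last n) - 1)),
        (((matC t s (d (Fin.last n))).det : ℚ) ^ 2) ^
          ((Fintype.card {a // expoDeg (Fin.init d) a = (i : ℤ) + s - (d (Fin.last n) - 1)} : ℤ) -
            Fintype.card {a // expoDeg (Fin.init d) a = (i : ℤ) + s - d (Fin.last n)}) := by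
  have hcard := card_expoDeg_symm d i t h
  rw [socleDegree_eq] at h
  have h1 : ∀ z, Fintype.card {m // expoDeg d m = z} = Fintype.card
      {m // adjoinDeg (expoDeg (Fin.init d)) (d (Fin.last n)) m = z} := fun z =>
    Fintype.card_congr ((expoEquiv d).subtypeEquiv fun m => by rw [expoDeg_eq]; rfl)
  rw [h1, h1] at hcard
  refine Eq.trans ?_ (gram_adjoinMul_pow (expoDeg_mem (Fin.init d))
    (lam_apply_eq_zero (Fin.init d)) ?_ ?_ i t _ (hd _) h hcard)
  · rw [lam_eq, submatrix_equiv_pow, expoDeg_eq]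
    exact gram_block_submatrix _ _ _ _ _ _ _
  · intro p hp
    have h2 := card_expoDeg_symm (Fin.init d) p (socleDegree (Fin.init d) - 2 * p) (by omega)
    rwa [show (p : ℤ) + ((socleDegree (Fin.init d) - 2 * p : ℕ) : ℤ) =
      socleDegree (Fin.init d) - p by omega] at h2
  · intro p hp
    have h2 := hG p (socleDegree (Fin.init d) - 2 * p) (by omega)
    rwa [show (p : ℤ) + ((socleDegree (Fin.init d) - 2 * p : ℕ) : ℤ) =
      socleDegree (Fin.init d) - p by omega] at h2

/-- The recursion needs nonvanishing for one variable fewer, and its factors are then nonzero by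
induction and by `det_matC_ne_zero`. -/
theorem gram_lam_pow_ne_zero {n : ℕ} (d : Fin n → ℕ) (hd : ∀ j, 1 ≤ d j) (i t : ℕ)
    (h : 2 * i + t = socleDegree d) :
    gram (block (expoDeg d) (expoDeg d) (lam ℚ d ^ t) (i + t) i) ≠ 0 := by
  induction n generalizing i t with
  | zero =>
    have h0 : socleDegree d = 0 := rfl
    obtain rfl : i = 0 := by omega
    obtain rfl : t = 0 := by omega
    rw [pow_zero, show ((0 : ℕ) : ℤ) + ((0 : ℕ) : ℤ) = ((0 : ℕ) : ℤ) from rfl, block_one, gram_one]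
    exact one_ne_zero
  | succ n ih =>
    have ih' := ih (Fin.init d) fun j => hd _
    rw [gram_lam_pow_eq d hd ih' i t h]
    rw [socleDegree_eq] at h
    refine mul_ne_zero (Finset.prod_ne_zero_iff.2 fun j hj => ?_)
      (Finset.prod_ne_zero_iff.2 fun s hs => ?_)
    · rw [Finset.mem_Icc] at hj
      have h2 := ih' (i - j) (socleDegree (Fin.init d) - 2 * (i - j)) (by omega)
      rwa [show ((i - j : ℕ) : ℤ) + ((socleDegree (Fin.init d) - 2 * (i - j) : ℕ) : ℤ) =
        socleDegree (Fin.init d) - (i - j : ℕ) by omega] at h2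
    · rw [Finset.mem_Icc] at hs
      have := hd (Fin.last n)
      exact zpow_ne_zero _ (pow_ne_zero _ (Int.cast_ne_zero.2
        (det_matC_ne_zero (by omega) (by omega))))

end Lam

/-! ### The determinants in terms of integer matrices -/

section Link

open MvPolynomial

variable (k : Type*) [Field k] {n : ℕ} (d : Fin n → ℕ)

/-- The class of a monomial in `A`. -/
def monoClass (m : (j : Fin n) → Fin (d j)) : Alg k d :=
  Ideal.Quotient.mk (powIdeal k d)
    (monomial (Finsupp.equivFunOnFinite.symm fun j => (m j : ℕ)) 1)

/-- The product is a basis monomial or, when an exponent reaches its bound, zero; in the latter case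
no index satisfies the condition in the sum. -/
theorem X_mul_monoClass (j : Fin n) (m : (j : Fin n) → Fin (d j)) :
    Ideal.Quotient.mk (powIdeal k d) (X j) * monoClass k d m =
      ∑ m' : (j : Fin n) → Fin (d j),
        (if ∀ l, (m' l : ℕ) = m l + if l = j then 1 else 0 then (1 : k) else 0) •
          monoClass k d m' := by
  have h1 : Ideal.Quotient.mk (powIdeal k d) (X j) * monoClass k d m =
      Ideal.Quotient.mk (powIdeal k d) (monomial
        (Finsupp.equivFunOnFinite.symm fun l => (m l : ℕ) + if l = j then 1 else 0) 1) := by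
    rw [monoClass, ← map_mul, X, monomial_mul, one_mul]
    congr 3
    ext l
    simp [Finsupp.single_apply, add_comm, eq_comm]
  rw [h1]
  by_cases hlt : ∀ l, (m l : ℕ) + (if l = j then 1 else 0) < d l
  · rw [Finset.sum_eq_single fun l => ⟨_, hlt l⟩]
    · simp [monoClass]
    · intro m' _ hm'
      rw [if_neg, zero_smul]
      exact fun h => hm' (funext fun l => Fin.ext (h l))
    · simp
  · rw [Finset.sum_eq_zero]
    · rw [Ideal.Quotient.eq_zero_iff_mem, mem_powIdeal]
      intro u hu
      rw [Finset.mem_singleton.1 (support_monomial_subset hu)]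
      push Not at hlt
      exact hlt
    · intro m' _
      rw [if_neg, zero_smul]
      exact fun h => hlt fun l => by rw [← h l]; exact (m' l).2

theorem sumVars_mul_monoClass (m : (j : Fin n) → Fin (d j)) :
    sumVars k d * monoClass k d m = ∑ m', lam k d m' m • monoClass k d m' := by
  rw [sumVars, map_sum, Finset.sum_mul]
  simp only [X_mul_monoClass, lam, of_apply, Finset.sum_smul]
  exact Finset.sum_comm

theorem sumVars_pow_mul_monoClass (t : ℕ) (m : (j : Fin n) → Fin (d j)) :
    sumVars k d ^ t * monoClass k d m = ∑ m', (lam k d ^ t) m' m • monoClass k d m' := by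
  induction t with
  | zero =>
    rw [Finset.sum_eq_single m]
    · simp
    · intro m' _ hm'
      rw [pow_zero, one_apply_ne hm', zero_smul]
    · simp
  | succ t ih =>
    rw [pow_succ', mul_assoc, ih, Finset.mul_sum]
    simp only [mul_smul_comm, sumVars_mul_monoClass, pow_succ', mul_apply, Finset.sum_smul,
      Finset.smul_sum, smul_smul]
    rw [Finset.sum_comm]
    exact Finset.sum_congr rfl fun _ _ => Finset.sum_congr rfl fun _ _ => by rw [mul_comm]

theorem mulPow_mon (i t : ℕ) (m : Expo d i) :
    mulPow (piece k d) (sumVars k d) (sumVars_mem k d) i t (monBasis k d i m) =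
      ∑ m' : Expo d (i + t), (lam k d ^ t) m'.1 m.1 • monBasis k d (i + t) m' := by
  apply Subtype.ext
  rw [AddSubmonoidClass.coe_finsetSum]
  have h1 : ∀ (i : ℕ) (m : Expo d i), (monBasis k d i m : Alg k d) = monoClass k d m.1 := by
    intro i m
    rw [monBasis, Module.Basis.mk_apply]
    rfl
  have h2 : ((mulPow (piece k d) (sumVars k d) (sumVars_mem k d) i t (monBasis k d i m) :
      piece k d (i + t)) : Alg k d) = sumVars k d ^ t * monoClass k d m.1 := by
    rw [← h1]
    rfl
  rw [h2, sumVars_pow_mul_monoClass]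
  simp only [Submodule.coe_smul, h1]
  rw [← Finset.sum_subtype (Finset.univ.filter fun m' : (j : Fin n) → Fin (d j) =>
    ∑ j, (m' j : ℕ) = i + t) (by simp) (fun m' => (lam k d ^ t) m' m.1 • monoClass k d m'),
    Finset.sum_filter_of_ne]
  intro m' _ hne
  by_contra hdeg
  refine hne ?_
  rw [pow_apply_eq_zero (lam_apply_eq_zero d), zero_smul]
  intro h3
  refine hdeg ?_
  have h4 := m.2
  simp only [expoDeg] at h3
  rw [← Nat.cast_sum, ← Nat.cast_sum, h4] at h3
  exact_mod_cast h3

/-- The determinant of `ℓ ^ t` as an integer. -/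
def intDet (i t : ℕ) (h : 2 * i + t = socleDegree d) : ℤ :=
  (of fun r c : Expo d i => (lam ℤ d ^ t) ((complEquiv d i t h).symm r).1 c.1).det

/-- The matrix of ℓ has entries that are images of integers, so the determinant over k is the image
of an integer which does not depend on k. -/
theorem lefschetzDet_eq (i t : ℕ) (h : 2 * i + t = socleDegree d) :
    lefschetzDet k d i t h = (intDet d i t h : k) := by
  have h1 : ((intDet d i t h : ℤ) : k) = Int.castRingHom k (intDet d i t h) := rfl
  rw [h1, intDet, RingHom.map_det, lefschetzDet]
  congr 1
  ext r c
  rw [LinearMap.toMatrix_apply, mulPow_mon, Module.Basis.repr_reindex,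
    Finsupp.mapDomain_equiv_apply, Module.Basis.repr_sum_self, RingHom.mapMatrix_apply, map_apply,
    of_apply, ← lam_pow_map d (Int.castRingHom k) t, map_apply]

theorem sq_intDet (i t : ℕ) (h : 2 * i + t = socleDegree d) :
    (intDet d i t h : ℚ) ^ 2 =
      gram (block (expoDeg d) (expoDeg d) (lam ℚ d ^ t) (i + t) i) := by
  have h1 : ((intDet d i t h : ℤ) : ℚ) = Int.castRingHom ℚ (intDet d i t h) := rfl
  have h2 : ∀ j : ℕ, ∀ m : (j : Fin n) → Fin (d j),
      ∑ l, (m l : ℕ) = j ↔ expoDeg d m = (j : ℤ) := by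
    intro j m
    rw [expoDeg, ← Nat.cast_sum, Nat.cast_inj]
  rw [h1, intDet, RingHom.map_det, ← gram_eq_sq,
    ← gram_submatrix ((complEquiv d i t h).symm.trans (Equiv.subtypeEquivRight (h2 (i + t))))
      (Equiv.subtypeEquivRight (h2 i)), ← lam_pow_map d (Int.castRingHom ℚ) t]
  rfl

theorem absVal_intCast [CharZero k] (z : ℤ) : absVal (z : k) = z.natAbs := by
  have h : {m : ℕ | (z : k) = (m : k) ∨ (z : k) = -(m : k)} = {z.natAbs} := by
    ext m
    simp only [Set.mem_ofPred_eq, Set.mem_singleton_iff]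
    rw [← Int.cast_natCast, ← Int.cast_neg, Int.cast_inj, Int.cast_inj]
    omega
  rw [absVal, h, csInf_singleton]

theorem absDet_eq [CharZero k] (i t : ℕ) (h : 2 * i + t = socleDegree d) :
    absDet k d i = (intDet d i t h).natAbs := by
  obtain rfl : t = socleDegree d - 2 * i := by omega
  rw [absDet, dif_pos (by omega), lefschetzDet_eq, absVal_intCast]

theorem sq_absDet [CharZero k] (i t : ℕ) (h : 2 * i + t = socleDegree d) :
    (absDet k d i : ℚ) ^ 2 =
      gram (block (expoDeg d) (expoDeg d) (lam ℚ d ^ t) (i + t) i) := by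
  rw [← sq_intDet d i t h, absDet_eq k d i t h, Nat.cast_natAbs, Int.cast_abs, sq_abs]

theorem absDet_ne_zero [CharZero k] (hd : ∀ j, 1 ≤ d j) (i t : ℕ)
    (h : 2 * i + t = socleDegree d) : absDet k d i ≠ 0 := by
  intro h0
  refine gram_lam_pow_ne_zero d hd i t h ?_
  rw [← sq_absDet k d i t h, h0]
  simp

theorem lefschetzDet_eq_or [CharZero k] (i t : ℕ) (h : 2 * i + t = socleDegree d) :
    lefschetzDet k d i t h = (absDet k d i : k) ∨
      lefschetzDet k d i t h = -(absDet k d i : k) := by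
  rw [lefschetzDet_eq, absDet_eq k d i t h, ← Int.cast_natCast, ← Int.cast_neg, Int.cast_inj,
    Int.cast_inj]
  omega

theorem hilb_eq (z : ℤ) : hilb k d z = Fintype.card {m // expoDeg d m = z} := by
  rw [hilb]
  split_ifs with h
  · lift z to ℕ using h
    rw [Int.toNat_natCast, Module.finrank_eq_card_basis (monBasis k d z), card_expoDeg]
  · symm
    rw [Fintype.card_eq_zero_iff]
    refine ⟨fun m => h ?_⟩
    rw [← m.2, expoDeg]
    positivity

/-- Both sides are nonnegative, so the identity follows from the one between their squares. -/
theorem absDet_recursion [CharZero k] {n : ℕ} (d : Fin (n + 1) → ℕ) (hd : ∀ j, 1 ≤ d j)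
    (i t : ℕ) (h : 2 * i + t = socleDegree d) :
    (absDet k d i : ℚ) =
      (∏ j ∈ Finset.Icc (d (Fin.last n) - t) (min i (d (Fin.last n) - 1)),
        (absDet k (Fin.init d) (i - j) : ℚ)) *
      ∏ s ∈ Finset.Icc (max 1 (d (Fin.last n) - i - 1)) (min (t - 1) (d (Fin.last n) - 1)),
        (|(matC t s (d (Fin.last n))).det| : ℚ) ^
          ((hilb k (Fin.init d) ((i : ℤ) + s - (d (Fin.last n) - 1)) : ℤ) -
            (hilb k (Fin.init d) ((i : ℤ) + s - d (Fin.last n)) : ℤ)) := by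
  rw [← sq_eq_sq₀ (by positivity) (by positivity), sq_absDet k d i t h,
    gram_lam_pow_eq d hd (gram_lam_pow_ne_zero _ fun j => hd _) i t h, mul_pow, ← Finset.prod_pow,
    ← Finset.prod_pow]
  rw [socleDegree_eq] at h
  congr 1
  · refine Finset.prod_congr rfl fun j hj => ?_
    rw [Finset.mem_Icc] at hj
    rw [sq_absDet k (Fin.init d) (i - j) (socleDegree (Fin.init d) - 2 * (i - j)) (by omega),
      show ((i - j : ℕ) : ℤ) + ((socleDegree (Fin.init d) - 2 * (i - j) : ℕ) : ℤ) =
        socleDegree (Fin.init d) - (i - j : ℕ) by omega]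
  · refine Finset.prod_congr rfl fun s _ => ?_
    rw [hilb_eq, hilb_eq, ← sq_abs, ← zpow_natCast, ← zpow_natCast, ← _root_.zpow_mul, ← _root_.zpow_mul,
      mul_comm]

end Link

/-! ### The strong Lefschetz property -/

section SLP

variable (k : Type*) [Field k] [CharZero k] {n : ℕ} (d : Fin n → ℕ)

theorem mulPow_bijective (hd : ∀ j, 1 ≤ d j) (i t : ℕ) (h : 2 * i + t = socleDegree d) :
    Function.Bijective (mulPow (piece k d) (sumVars k d) (sumVars_mem k d) i t) := by
  have hdet : lefschetzDet k d i t h ≠ 0 := by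
    have h1 : (absDet k d i : k) ≠ 0 := Nat.cast_ne_zero.2 (absDet_ne_zero k d hd i t h)
    rcases lefschetzDet_eq_or k d i t h with h2 | h2
    · rwa [h2]
    · rwa [h2, neg_ne_zero]
  have hinj : Function.Injective (mulPow (piece k d) (sumVars k d) (sumVars_mem k d) i t) := by
    rw [injective_iff_map_eq_zero]
    intro x hx
    have h1 := LinearMap.toMatrix_mulVec_repr (monBasis k d i)
      ((monBasis k d (i + t)).reindex (complEquiv d i t h))
      (mulPow (piece k d) (sumVars k d) (sumVars_mem k d) i t) x
    rw [hx, map_zero, Finsupp.coe_zero] at h1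
    have h2 := eq_zero_of_mulVec_eq_zero hdet h1
    exact (monBasis k d i).repr.map_eq_zero_iff.1 (DFunLike.coe_injective h2)
  have := (monBasis k d i).finiteDimensional_of_finite
  have := (monBasis k d (i + t)).finiteDimensional_of_finite
  refine ⟨hinj, (LinearMap.injective_iff_surjective_of_finrank_eq_finrank ?_).1 hinj⟩
  rw [Module.finrank_eq_card_basis (monBasis k d i),
    Module.finrank_eq_card_basis (monBasis k d (i + t)), Fintype.card_congr (complEquiv d i t h)]

theorem piece_eq_bot (k : Type*) [Field k] {n : ℕ} (d : Fin n → ℕ) (i : ℕ) (h : socleDegree d < i) : piece k d i = ⊥ := by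
  have : IsEmpty (Expo d i) := ⟨fun m => by
    have := sum_rev m.1
    have := m.2
    omega⟩
  have h1 := (monBasis k d i).repr.injective.subsingleton
  rwa [← Submodule.subsingleton_iff_eq_bot]

/-- If 2i + t ≤ e, then ℓ^t is the first factor of the bijection A_i → A_{e-i}, hence injective.
Otherwise it is the last factor of a bijection onto A_{i+t}, or its target is zero. -/
theorem hasSLP (hd : ∀ j, 1 ≤ d j) : HasSLP (piece k d) := by
  refine ⟨sumVars k d, sumVars_mem k d, fun i t => ?_⟩
  have hval : ∀ i t (x : piece k d i),
      (mulPow (piece k d) (sumVars k d) (sumVars_mem k d) i t x : Alg k d) =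
        sumVars k d ^ t * x := fun _ _ _ => rfl
  by_cases h1 : 2 * i + t ≤ socleDegree d
  · left
    rw [injective_iff_map_eq_zero]
    intro x hx
    have h2 := (mulPow_bijective k d hd i (socleDegree d - 2 * i) (by omega)).1
    rw [injective_iff_map_eq_zero] at h2
    refine h2 x (Subtype.ext ?_)
    have h3 := congrArg Subtype.val hx
    rw [hval] at h3 ⊢
    rw [show socleDegree d - 2 * i = socleDegree d - 2 * i - t + t by omega, pow_add, mul_assoc,
      h3]
    exact mul_zero _
  right
  intro y
  by_cases h2 : i + t ≤ socleDegree d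
  -- The degree opposite to i + t; it is less than i because 2i + t > e.
  · obtain ⟨j, hj⟩ : ∃ j, j = socleDegree d - (i + t) := ⟨_, rfl⟩
    have hy : (y : Alg k d) ∈ piece k d (j + (socleDegree d - 2 * j)) := by
      rw [show j + (socleDegree d - 2 * j) = i + t by omega]
      exact y.2
    obtain ⟨x, hx⟩ := (mulPow_bijective k d hd j (socleDegree d - 2 * j) (by omega)).2 ⟨y, hy⟩
    have hx' : sumVars k d ^ (i - j) * (x : Alg k d) ∈ piece k d i := by
      have h3 := (mulPow (piece k d) (sumVars k d) (sumVars_mem k d) j (i - j) x).2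
      rw [hval] at h3
      rwa [show j + (i - j) = i by omega] at h3
    refine ⟨⟨_, hx'⟩, Subtype.ext ?_⟩
    have h3 := congrArg Subtype.val hx
    rw [hval] at h3 ⊢
    rw [← mul_assoc, ← pow_add, show t + (i - j) = socleDegree d - 2 * j by omega]
    exact h3
  · refine ⟨0, Subtype.ext ?_⟩
    have hy := (Submodule.mem_bot k).1 ((piece_eq_bot k d (i + t) (by omega)).le y.2)
    rw [map_zero, hy]
    rfl

end SLP

end MonomialCI

end

theorem theorem4p1 {k : Type*} [Field k] [CharZero k] {n : ℕ} (d : Fin (n + 1) → ℕ)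
    (hd : ∀ j, 1 ≤ d j) :
    (∀ (i t : ℕ) (h : 2 * i + t = MonomialCI.socleDegree d),
      (MonomialCI.lefschetzDet k d i t h = (MonomialCI.absDet k d i : k) ∨
        MonomialCI.lefschetzDet k d i t h = -(MonomialCI.absDet k d i : k)) ∧
      (MonomialCI.absDet k d i : ℚ) =
        (∏ j ∈ Finset.Icc (d (Fin.last n) - t) (min i (d (Fin.last n) - 1)),
          (MonomialCI.absDet k (Fin.init d) (i - j) : ℚ)) *
        ∏ s ∈ Finset.Icc (max 1 (d (Fin.last n) - i - 1)) (min (t - 1) (d (Fin.last n) - 1)),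
          (|(MonomialCI.matC t s (d (Fin.last n))).det| : ℚ) ^
            ((MonomialCI.hilb k (Fin.init d) ((i : ℤ) + s - (d (Fin.last n) - 1)) : ℤ) -
              (MonomialCI.hilb k (Fin.init d) ((i : ℤ) + s - d (Fin.last n)) : ℤ)) ∧
      MonomialCI.absDet k d i ≠ 0) ∧
    MonomialCI.HasSLP (MonomialCI.piece k d) :=
  ⟨fun i t h => ⟨MonomialCI.lefschetzDet_eq_or k d i t h,
    MonomialCI.absDet_recursion k d hd i t h, MonomialCI.absDet_ne_zero k d hd i t h⟩,
    MonomialCI.hasSLP k d hd⟩
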